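/- Let $K$ be a field, $A$ a finite-dimensional (associative, unital) $K$-algebra, and $G$ a finite group acting on $A$ by $K$-algebra automorphisms, with $\operatorname{char} K \nmid |G|$. Let $A\ast G = A\otimes_K KG$ be the skew group algebra, with multiplication determined by $ga = g(a)g$ for $g\in G$, $a\in A$. All modules are left modules. For a $K$-algebra $R$ let $J(R)$ be its Jacobson radical. For $R$-modules $X,Y,Z$, the Yoneda product of $\alpha\in\operatorname{Ext}^i_R(X,Y)$ and $\beta\in\operatorname{Ext}^j_R(Y,Z)$ is written $\alpha\beta\in\operatorname{Ext}^{i+j}_R(X,Z)$ (composition from left to right), and $\operatorname{Ext}^i_R(X,Y)\operatorname{Ext}^j_R(Y,Z)$ is the $K$-span of all such products; $\operatorname{Ext}^*_R(X,X)=\bigoplus_{i\ge 0}\operatorname{Ext}^i_R(X,X)$ is a graded $K$-algebra under this product. An $R$-module $M$ is called quasi-Koszul if $\operatorname{Ext}^i_R(M,R/J(R))\,\operatorname{Ext}^1_R(R/J(R),R/J(R))=\operatorname{Ext}^{i+1}_R(M,R/J(R))$ for all $i\ge 0$. The algebra $R$ is called quasi-Koszul if $E=\operatorname{Ext}^*_R(R/J(R),R/J(R))$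 is generated in degrees $0$ and $1$, i.e. $E_i=(E_1)^i$ for all $i\ge 2$. Then: (1) For every finitely generated $A\ast G$-module $M$, the $A\ast G$-module $M\otimes_K KG$, with action $(ag)(m\otimes h)=agm\otimes gh$, is quasi-Koszul if and only if $M$, regarded as an $A$-module, is quasi-Koszul. (2) The algebra $A\ast G$ is quasi-Koszul if and only if $A$ is quasi-Koszul. (3) Put $J=J(A)$. The group $G$ acts on $A/J$ by $g(a+J)=g(a)+J$, and it acts on $\operatorname{Ext}^*_A(A/J,A/J)$ by graded $K$-algebra automorphisms as follows: for $g\in G$ and $\xi\in\operatorname{Ext}^i_A(A/J,A/J)$, let $\xi^{g^{-1}}$ be the image of $\xi$ under the exact functor that keeps the underlying vector space of an $A$-module and lets $a\in A$ act as $g^{-1}(a)$, and let $g\xi$ be obtained from $\xi^{g^{-1}}$ by identifying both ends $(A/J)^{g^{-1}}$ with $A/J$ through the $A$-isomorphism $x\mapsto gx$ (for $i=0$ this is $(g\varphi)(x)=g\varphi(g^{-1}x)$). With respect to this action, $$\operatorname{Ext}^*_{A\ast G}\bigl((A\ast G)/J(A\ast G),(A\ast G)/J(A\ast G)\bigr)\;\cong\;\operatorname{Ext}^*_A(A/J,A/J)\ast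 G$$ as graded $K$-algebras, where the component of degree $n$ of the right side is $\operatorname{Ext}^n_A(A/J,A/J)\otimes_K KG$. -/

import Mathlib

noncomputable section

open CategoryTheory CategoryTheory.Limits
open CategoryTheory.Abelian (Ext)
open scoped DirectSum TensorProduct

namespace YonedaExt

universe w v u

section YonedaAlgebra

variable {C : Type u} [Category.{v} C] [Abelian C] [HasExt.{w} C]

theorem mk_comp {X Y Z : C} {a b c : ℕ} (α : Ext X Y a) (β : Ext Y Z b) (h : a + b = c) :
    (⟨a + b, α.comp β rfl⟩ : Σ i, Ext X Z i) = ⟨c, α.comp β h⟩ := by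
  subst h
  rfl

instance gone (X : C) : GradedMonoid.GOne (fun n : ℕ => Ext X X n) where
  one := Ext.mk₀ (𝟙 X)

instance gmul (X : C) : GradedMonoid.GMul (fun n : ℕ => Ext X X n) where
  mul α β := α.comp β rfl

instance gmonoid (X : C) : GradedMonoid.GMonoid (fun n : ℕ => Ext X X n) where
  one_mul := by
    rintro ⟨n, α⟩
    exact (mk_comp (Ext.mk₀ (𝟙 X)) α (zero_add n)).trans (by rw [Ext.mk₀_id_comp])
  mul_one := by
    rintro ⟨n, α⟩
    exact (mk_comp α (Ext.mk₀ (𝟙 X)) (add_zero n)).trans (by rw [Ext.comp_mk₀_id])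
  mul_assoc := by
    rintro ⟨a, α⟩ ⟨b, β⟩ ⟨c, γ⟩
    refine (mk_comp (α.comp β rfl) γ (add_assoc a b c)).trans ?_
    rw [Ext.comp_assoc α β γ rfl rfl (add_assoc a b c)]
    rfl

instance gring (X : C) : DirectSum.GRing (fun n : ℕ => Ext X X n) where
  mul_zero _ := Ext.comp_zero ..
  zero_mul _ := Ext.zero_comp ..
  mul_add _ _ _ := Ext.comp_add ..
  add_mul _ _ _ := Ext.add_comp ..
  natCast n := n • Ext.mk₀ (𝟙 X)
  natCast_zero := zero_smul _ _
  natCast_succ n := succ_nsmul _ n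
  intCast n := n • Ext.mk₀ (𝟙 X)
  intCast_ofNat _ := natCast_zsmul _ _
  intCast_negSucc_ofNat _ := negSucc_zsmul _ _

variable (K : Type*) [Field K] [Linear K C]

instance galgebra (X : C) : DirectSum.GAlgebra K (fun n : ℕ => Ext X X n) where
  toFun :=
    { toFun := fun r => r • Ext.mk₀ (𝟙 X)
      map_zero' := zero_smul _ _
      map_add' := fun r s => add_smul r s _ }
  map_one := one_smul _ _
  map_mul r s := by
    refine Eq.trans ?_ (mk_comp (r • Ext.mk₀ (𝟙 X)) (s • Ext.mk₀ (𝟙 X)) (zero_add 0)).symm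
    rw [Ext.smul_comp, Ext.comp_smul, Ext.mk₀_id_comp, smul_smul]
    rfl
  commutes := by
    rintro r ⟨n, α⟩
    refine (mk_comp (r • Ext.mk₀ (𝟙 X)) α (zero_add n)).trans
      (Eq.trans ?_ (mk_comp α (r • Ext.mk₀ (𝟙 X)) (add_zero n)).symm)
    simp
  smul_def := by
    rintro r ⟨n, α⟩
    refine Eq.trans ?_ (mk_comp (r • Ext.mk₀ (𝟙 X)) α (zero_add n)).symm
    simp
    rfl

/-- `Ext^*(X, X)` with the Yoneda product, the product of `α` and `β` being "first `α`, then `β`". -/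
abbrev YonedaAlgebra (X : C) : Type w := ⨁ n : ℕ, Ext X X n

/-- The component of degree `n` of the Yoneda algebra. -/
def yonedaGrade (X : C) (n : ℕ) : Submodule K (YonedaAlgebra X) :=
  LinearMap.range (DirectSum.lof K ℕ (fun n : ℕ => Ext X X n) n)

end YonedaAlgebra

section Map

variable {C : Type u} [Category.{v} C] [Abelian C] [HasExt.{w} C] [EnoughProjectives C]

attribute [local instance] Ext.subsingleton_of_projective in
theorem ext_induction {motive : ∀ (X Y : C) (n : ℕ), Ext X Y n → Prop}
    (zero : ∀ (X Y : C) (f : X ⟶ Y), motive X Y 0 (Ext.mk₀ f))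
    (succ : ∀ (S : ShortComplex C) (hS : S.ShortExact) (Y : C) (n : ℕ) (y : Ext S.X₁ Y n),
      motive S.X₁ Y n y → motive S.X₃ Y (n + 1) (hS.extClass.comp y (add_comm 1 n)))
    {X Y : C} {n : ℕ} (x : Ext X Y n) : motive X Y n x := by
  induction n generalizing X with
  | zero =>
    obtain ⟨f, rfl⟩ := (Ext.mk₀_bijective X Y).2 x
    exact zero _ _ f
  | succ n ih =>
    let P : ProjectivePresentation X := Classical.arbitrary _
    let S := ShortComplex.mk _ _ (kernel.condition P.f)
    have hP : Projective S.X₂ := P.projective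
    have hS : S.ShortExact := { exact := ShortComplex.exact_kernel P.f }
    obtain ⟨y, rfl⟩ := Ext.contravariant_sequence_exact₃ hS Y x (by subsingleton) (add_comm 1 n)
    exact succ S hS Y n y (ih y)

variable {D : Type u} [Category.{v} D] [Abelian D] [HasExt.{w} D]
variable {E : Type u} [Category.{v} E] [Abelian E] [HasExt.{w} E]

theorem mapExactFunctor_natTrans (F F' : C ⥤ D)
    [F.Additive] [PreservesFiniteLimits F] [PreservesFiniteColimits F]
    [F'.Additive] [PreservesFiniteLimits F'] [PreservesFiniteColimits F'] (τ : F ⟶ F')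
    {X Y : C} {n : ℕ} (x : Ext X Y n) :
    (x.mapExactFunctor F).comp (Ext.mk₀ (τ.app Y)) (add_zero n) =
      (Ext.mk₀ (τ.app X)).comp (x.mapExactFunctor F') (zero_add n) := by
  induction x using ext_induction with
  | zero X Y f => simp [Ext.mapExactFunctor_mk₀]
  | succ S hS Y n y ih =>
    have key : (hS.extClass.mapExactFunctor F).comp (Ext.mk₀ (τ.app S.X₁)) (add_zero 1) =
        (Ext.mk₀ (τ.app S.X₃)).comp (hS.extClass.mapExactFunctor F') (zero_add 1) := by
      rw [Ext.mapExactFunctor_extClass, Ext.mapExactFunctor_extClass]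
      exact ShortComplex.ShortExact.extClass_naturality (hS.map_of_exact F) (hS.map_of_exact F')
        (S.mapNatTrans τ)
    rw [Ext.mapExactFunctor_comp, Ext.mapExactFunctor_comp, Ext.comp_assoc_of_third_deg_zero, ih,
      ← Ext.comp_assoc_of_second_deg_zero, key, Ext.comp_assoc]
    lia

theorem mapExactFunctor_id {X Y : C} {n : ℕ} (x : Ext X Y n) :
    x.mapExactFunctor (𝟭 C) = x := by
  induction x using ext_induction with
  | zero X Y f => rw [Ext.mapExactFunctor_mk₀]; rfl
  | succ S hS Y n y ih =>
    rw [Ext.mapExactFunctor_comp, Ext.mapExactFunctor_extClass, ih]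
    rfl

theorem mapExactFunctor_functor_comp (F : C ⥤ D) (F' : D ⥤ E)
    [F.Additive] [PreservesFiniteLimits F] [PreservesFiniteColimits F]
    [F'.Additive] [PreservesFiniteLimits F'] [PreservesFiniteColimits F']
    {X Y : C} {n : ℕ} (x : Ext X Y n) :
    x.mapExactFunctor (F ⋙ F') = (x.mapExactFunctor F).mapExactFunctor F' := by
  induction x using ext_induction with
  | zero X Y f => simp only [Ext.mapExactFunctor_mk₀]; rfl
  | succ S hS Y n y ih =>
    have key : hS.extClass.mapExactFunctor (F ⋙ F') =
        (hS.extClass.mapExactFunctor F).mapExactFunctor F' := by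
      rw [Ext.mapExactFunctor_extClass, Ext.mapExactFunctor_extClass]
      exact (Ext.mapExactFunctor_extClass F' (hS.map_of_exact F)).symm
    rw [Ext.mapExactFunctor_comp, Ext.mapExactFunctor_comp, Ext.mapExactFunctor_comp, ih, key]

end Map

section Action

variable {A G : Type u} [Ring A] [Group G] [MulSemiringAction G A]

theorem restrictScalars_map_exact {R S : Type u} [Ring R] [Ring S] (f : R →+* S)
    (T : ShortComplex (ModuleCat.{u} S)) (h : T.Exact) :
    (T.map (ModuleCat.restrictScalars.{u} f)).Exact := by
  rw [CategoryTheory.ShortComplex.ShortExact.moduleCat_exact_iff_function_exact] at h ⊢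
  exact h

variable (A) in
/-- For `g : G`, the functor sending an `A`-module `X` to the additive group `X` on which
`a` acts as `g⁻¹ • a` does on `X`. -/
def twist (g : G) : ModuleCat.{u} A ⥤ ModuleCat.{u} A :=
  ModuleCat.restrictScalars (MulSemiringAction.toRingHom G A g⁻¹)

instance twist_additive (g : G) : (twist A g).Additive :=
  inferInstanceAs (ModuleCat.restrictScalars _).Additive

instance twist_preservesFiniteLimits (g : G) : PreservesFiniteLimits (twist A g) :=
  (((Functor.exact_tfae (twist A g)).out 1 3 (a := ∀ S : ShortComplex (ModuleCat.{u} A), S.Exact →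
    (S.map (twist A g)).Exact) (b := PreservesFiniteLimits (twist A g) ∧
    PreservesFiniteColimits (twist A g))).mp (restrictScalars_map_exact _)).1

instance twist_preservesFiniteColimits (g : G) : PreservesFiniteColimits (twist A g) :=
  (((Functor.exact_tfae (twist A g)).out 1 3 (a := ∀ S : ShortComplex (ModuleCat.{u} A), S.Exact →
    (S.map (twist A g)).Exact) (b := PreservesFiniteLimits (twist A g) ∧
    PreservesFiniteColimits (twist A g))).mp (restrictScalars_map_exact _)).2

instance twist_linear (K : Type u) [Field K] [Algebra K A] [SMulCommClass G K A] (g : G) :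
    (twist A g).Linear K where
  map_smul {X Y} f r := by
    ext x
    change algebraMap K A r • f.hom x = (g⁻¹ • algebraMap K A r) • f.hom x
    rw [smul_algebraMap]

section

variable (X : ModuleCat.{u} A) [DistribMulAction G X] [SMulDistribClass G A X]

/-- The `A`-linear map from `X` to its twist by `g` given by `x ↦ g⁻¹ • x`. -/
def toTwist (g : G) : X ⟶ (twist A g).obj X :=
  ModuleCat.ofHom (Y := (twist A g).obj X)
    { toFun := fun x => (g⁻¹ • x : X)
      map_add' := fun x y => smul_add g⁻¹ x y
      map_smul' := fun a x => smul_distrib_smul g⁻¹ a x }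

/-- The `A`-linear map from the twist of `X` by `g` to `X` given by `x ↦ g • x`. -/
def fromTwist (g : G) : (twist A g).obj X ⟶ X :=
  ModuleCat.ofHom (X := (twist A g).obj X)
    { toFun := fun x => (g • (show X from x) : X)
      map_add' := fun x y => smul_add g (show X from x) (show X from y)
      map_smul' := fun a x => by
        change g • ((g⁻¹ • a) • (show X from x)) = a • g • (show X from x)
        rw [smul_distrib_smul, smul_inv_smul] }

theorem toTwist_fromTwist (g : G) : toTwist X g ≫ fromTwist X g = 𝟙 X := by
  ext x
  exact smul_inv_smul g x

theorem fromTwist_toTwist (g : G) : fromTwist X g ≫ toTwist X g = 𝟙 _ := by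
  ext x
  exact inv_smul_smul g (show X from x)

end

variable (A G) in
/-- The twist by `1` is the identity functor. -/
def twistOne : twist A (1 : G) ⟶ 𝟭 (ModuleCat.{u} A) where
  app X := ModuleCat.ofHom (X := (twist A (1 : G)).obj X) (Y := X)
    { toFun := fun x => x
      map_add' := fun _ _ => rfl
      map_smul' := fun a x => by
        change ((1 : G)⁻¹ • a) • (show X from x) = a • (show X from x)
        rw [inv_one, one_smul] }

variable (A) in
/-- The twist by `h` followed by the twist by `g` is the twist by `g * h`. -/
def twistMul (g h : G) : twist A h ⋙ twist A g ⟶ twist A (g * h) where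
  app X := ModuleCat.ofHom (X := (twist A g).obj ((twist A h).obj X)) (Y := (twist A (g * h)).obj X)
    { toFun := fun x => x
      map_add' := fun _ _ => rfl
      map_smul' := fun a x => by
        change (h⁻¹ • g⁻¹ • a) • (show X from x) = ((g * h)⁻¹ • a) • (show X from x)
        rw [mul_inv_rev, mul_smul] }

section

variable (X Y Z : ModuleCat.{u} A) [DistribMulAction G X] [SMulDistribClass G A X]
  [DistribMulAction G Y] [SMulDistribClass G A Y] [DistribMulAction G Z] [SMulDistribClass G A Z]

/-- The action of `g` on `Ext^n(X, Y)`: an extension is twisted by `g` and its ends are identified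
with `X` and `Y` through the action of `g`. In degree `0` this is `(g φ)(x) = g φ(g⁻¹ x)`. -/
def extAct (g : G) (n : ℕ) : Ext X Y n →+ Ext X Y n where
  toFun ξ := (Ext.mk₀ (toTwist X g)).comp
    ((ξ.mapExactFunctor (twist A g)).comp (Ext.mk₀ (fromTwist Y g)) (add_zero n)) (zero_add n)
  map_zero' := by simp
  map_add' ξ ζ := by simp

variable {X Y Z}

theorem extAct_def (g : G) {n : ℕ} (ξ : Ext X Y n) : extAct X Y g n ξ =
    (Ext.mk₀ (toTwist X g)).comp ((ξ.mapExactFunctor (twist A g)).comp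
      (Ext.mk₀ (fromTwist Y g)) (add_zero n)) (zero_add n) := rfl

theorem extAct_mk₀ (g : G) (f : X ⟶ Y) : extAct X Y g 0 (Ext.mk₀ f) =
    Ext.mk₀ (toTwist X g ≫ (twist A g).map f ≫ fromTwist Y g) := by
  simp [extAct_def, Ext.mapExactFunctor_mk₀]

theorem extAct_one {n : ℕ} (ξ : Ext X Y n) : extAct X Y (1 : G) n ξ = ξ := by
  have hY : fromTwist Y (1 : G) = (twistOne A G).app Y := by
    ext y
    exact one_smul G (show Y from y)
  have hX : toTwist X (1 : G) ≫ (twistOne A G).app X = 𝟙 X := by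
    ext x
    change (1 : G)⁻¹ • x = x
    rw [inv_one, one_smul]
  rw [extAct_def, hY, mapExactFunctor_natTrans (twist A (1 : G)) (𝟭 _) (twistOne A G) ξ,
    Ext.mk₀_comp_mk₀_assoc, hX, mapExactFunctor_id]
  exact Ext.mk₀_id_comp ξ

theorem extAct_mul (g h : G) {n : ℕ} (ξ : Ext X Y n) :
    extAct X Y (g * h) n ξ = extAct X Y g n (extAct X Y h n ξ) := by
  have hX : (toTwist X g ≫ (twist A g).map (toTwist X h)) ≫ (twistMul A g h).app X =
      toTwist X (g * h) := by
    ext x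
    change h⁻¹ • g⁻¹ • x = (g * h)⁻¹ • x
    rw [mul_inv_rev, mul_smul]
  have hY : (twist A g).map (fromTwist Y h) ≫ fromTwist Y g =
      (twistMul A g h).app Y ≫ fromTwist Y (g * h) := by
    ext y
    exact (mul_smul g h (show Y from y)).symm
  have nat := mapExactFunctor_natTrans _ _ (twistMul A g h) ξ
  rw [mapExactFunctor_functor_comp] at nat
  rw [extAct_def (g * h), extAct_def g, extAct_def h, Ext.mapExactFunctor_comp,
    Ext.mapExactFunctor_comp, Ext.mapExactFunctor_mk₀, Ext.mapExactFunctor_mk₀,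
    Ext.comp_assoc_of_third_deg_zero, Ext.comp_assoc_of_third_deg_zero, Ext.mk₀_comp_mk₀, hY,
    ← Ext.mk₀_comp_mk₀, Ext.mk₀_comp_mk₀_assoc, ← hX, ← Ext.mk₀_comp_mk₀_assoc]
  congr 1
  rw [← Ext.comp_assoc_of_third_deg_zero, ← Ext.comp_assoc_of_third_deg_zero]
  exact congrArg (fun z => Ext.comp z (Ext.mk₀ (fromTwist Y (g * h))) (add_zero n)) nat.symm

theorem extAct_comp (g : G) {a b c : ℕ} (α : Ext X Y a) (β : Ext Y Z b) (h : a + b = c) :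
    extAct X Z g c (α.comp β h) = (extAct X Y g a α).comp (extAct Y Z g b β) h := by
  rw [extAct_def, extAct_def, extAct_def, Ext.mapExactFunctor_comp,
    Ext.comp_assoc (Ext.mk₀ (toTwist X g)) _ _ (zero_add a) h (by lia)]
  congr 1
  rw [Ext.comp_assoc_of_third_deg_zero, Ext.comp_assoc_of_second_deg_zero,
    Ext.mk₀_comp_mk₀_assoc, fromTwist_toTwist, Ext.mk₀_id_comp]

theorem extAct_smul {K : Type u} [Field K] [Algebra K A] [SMulCommClass G K A] (g : G) (r : K)
    {n : ℕ} (ξ : Ext X Y n) : extAct X Y g n (r • ξ) = r • extAct X Y g n ξ := by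
  simp [extAct_def]

end

variable (X : ModuleCat.{u} A) [DistribMulAction G X] [SMulDistribClass G A X]

/-- The action of `G` on the Yoneda algebra of an `A`-module with a compatible action of `G`. -/
instance yonedaAction : MulSemiringAction G (YonedaAlgebra X) where
  smul g := DirectSum.map (extAct X X g)
  one_smul x := by
    change DirectSum.map (extAct X X (1 : G)) x = x
    have : extAct X X (1 : G) = fun n => AddMonoidHom.id _ := by
      ext n ξ
      exact extAct_one ξ
    rw [this, DirectSum.map_id]
    rfl
  mul_smul g h x := by
    change DirectSum.map (extAct X X (g * h)) x =
      DirectSum.map (extAct X X g) (DirectSum.map (extAct X X h) x)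
    have : extAct X X (g * h) = fun n => (extAct X X g n).comp (extAct X X h n) := by
      ext n ξ
      exact extAct_mul g h ξ
    rw [this, DirectSum.map_comp]
    rfl
  smul_zero g := map_zero (DirectSum.map (extAct X X g))
  smul_add g := map_add (DirectSum.map (extAct X X g))
  smul_one g := by
    change DirectSum.map (extAct X X g) 1 = 1
    rw [DirectSum.one_def, DirectSum.map_of]
    refine congrArg _ ((extAct_mk₀ g (𝟙 X)).trans ?_)
    rw [CategoryTheory.Functor.map_id, Category.id_comp, toTwist_fromTwist]
    rfl
  smul_mul g x y := by
    change DirectSum.map (extAct X X g) (x * y) =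
      DirectSum.map (extAct X X g) x * DirectSum.map (extAct X X g) y
    induction x using DirectSum.induction_on with
    | zero => simp
    | add x x' hx hx' => simp only [add_mul, map_add, hx, hx']
    | of a α =>
      induction y using DirectSum.induction_on with
      | zero => simp
      | add y y' hy hy' => simp only [mul_add, map_add, hy, hy']
      | of b β =>
        rw [DirectSum.of_mul_of, DirectSum.map_of, DirectSum.map_of, DirectSum.map_of,
          DirectSum.of_mul_of]
        exact congrArg _ (extAct_comp g α β rfl)

theorem smul_of (g : G) (n : ℕ) (ξ : Ext X X n) :
    g • (DirectSum.of (fun n : ℕ => Ext X X n) n ξ : YonedaAlgebra X) =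
      DirectSum.of (fun n : ℕ => Ext X X n) n (extAct X X g n ξ) :=
  DirectSum.map_of _ _ _

instance yonedaAction_smulComm (K : Type u) [Field K] [Algebra K A] [SMulCommClass G K A] :
    SMulCommClass G K (YonedaAlgebra X) where
  smul_comm g r x := by
    induction x using DirectSum.induction_on with
    | zero => simp
    | add x x' hx hx' => simp only [smul_add, hx, hx']
    | of a α =>
      change g • r • DirectSum.lof K ℕ (fun n : ℕ => Ext X X n) a α =
        r • g • DirectSum.lof K ℕ (fun n : ℕ => Ext X X n) a α
      rw [← map_smul]
      change g • DirectSum.of (fun n : ℕ => Ext X X n) a (r • α) =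
        r • g • DirectSum.of (fun n : ℕ => Ext X X n) a α
      rw [smul_of, smul_of, extAct_smul]
      exact (DirectSum.lof K ℕ (fun n : ℕ => Ext X X n) a).map_smul r _

end Action

section QuasiKoszul

variable (K R : Type u) [Field K] [Ring R] [Algebra K R]

/-- The left `R`-module `R / J(R)`, where `J(R)` is the Jacobson radical of `R`. -/
def radQuot : ModuleCat.{u} R := ModuleCat.of R (R ⧸ Ring.jacobson R)

/-- The algebra `R` is quasi-Koszul if `E = Ext^*_R(R/J, R/J)` is generated in degrees `0` and `1`,
that is, `E_i = (E_1)^i` for all `i ≥ 2`. -/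
def IsQuasiKoszulAlgebra : Prop :=
  ∀ i : ℕ, 2 ≤ i → yonedaGrade K (radQuot R) i = yonedaGrade K (radQuot R) 1 ^ i

/-- The `R`-module `M` is quasi-Koszul if `Ext^i_R(M, R/J) Ext^1_R(R/J, R/J) = Ext^{i+1}_R(M, R/J)`
for all `i ≥ 0`, the left side being the `K`-subspace spanned by the Yoneda products. -/
def IsQuasiKoszulModule (M : ModuleCat.{u} R) : Prop :=
  ∀ i : ℕ, Submodule.span K {ξ : Ext M (radQuot R) (i + 1) |
    ∃ (α : Ext M (radQuot R) i) (β : Ext (radQuot R) (radQuot R) 1), α.comp β rfl = ξ} = ⊤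

end QuasiKoszul

section Skew

variable {K A G : Type u} [Field K] [Ring A] [Algebra K A] [Group G] [MulSemiringAction G A]
  [SMulCommClass G K A]

instance ringHomSurjective (g : G) : RingHomSurjective (MulSemiringAction.toRingHom G A g) :=
  ⟨MulAction.surjective g⟩

variable (A) in
/-- The map `a + J ↦ g a + J` on `A / J(A)`. -/
def topMap (g : G) : (A ⧸ Ring.jacobson A) →ₛₗ[MulSemiringAction.toRingHom G A g]
    (A ⧸ Ring.jacobson A) :=
  Submodule.mapQ (Ring.jacobson A) (Ring.jacobson A)
    (MulSemiringAction.toRingHom G A g).toSemilinearMap (Ring.le_comap_jacobson _)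

/-- The action of `G` on `A / J(A)` induced by that on `A`. -/
instance topAction : DistribMulAction G (radQuot A) where
  smul g x := topMap A g x
  one_smul x := by
    obtain ⟨a, rfl⟩ := Submodule.Quotient.mk_surjective _ x
    exact congrArg Submodule.Quotient.mk (one_smul G a)
  mul_smul g h x := by
    obtain ⟨a, rfl⟩ := Submodule.Quotient.mk_surjective _ x
    exact congrArg Submodule.Quotient.mk (mul_smul g h a)
  smul_zero g := map_zero (topMap A g)
  smul_add g := map_add (topMap A g)

instance topAction_smulDistrib : SMulDistribClass G A (radQuot A) where
  smul_distrib_smul g a x := map_smulₛₗ (topMap A g) a x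

/-- The `A * G`-module `M`, viewed as an `A`-module. -/
abbrev resA (M : ModuleCat.{u} (SkewMonoidAlgebra A G)) : ModuleCat.{u} A :=
  (ModuleCat.restrictScalars (SkewMonoidAlgebra.singleOneRingHom (k := A) (G := G))).obj M

section Tensor

open scoped ModuleCat

variable (M : ModuleCat.{u} (SkewMonoidAlgebra A G)) {W : Type u} [AddCommGroup W] [Module K W]
  (ρ : Representation K G W)

/-- The ring homomorphism `A * G → End_K(M ⊗ W)` with `(a g)(m ⊗ w) = (a g m) ⊗ (g w)`. -/
def tensorHom : SkewMonoidAlgebra A G →+* Module.End K (M ⊗[K] W) :=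
  SkewMonoidAlgebra.liftNCRingHom
    { toFun := fun a => LinearMap.rTensor W
        (Algebra.lsmul K K M (SkewMonoidAlgebra.single (1 : G) a))
      map_one' := by
        rw [← SkewMonoidAlgebra.one_def, map_one]
        exact LinearMap.rTensor_id _ _
      map_zero' := by
        rw [SkewMonoidAlgebra.single_zero, map_zero, LinearMap.rTensor_zero]
      map_add' := fun a b => by
        rw [SkewMonoidAlgebra.single_add, map_add, LinearMap.rTensor_add]
      map_mul' := fun a b => by
        rw [← LinearMap.rTensor_mul, ← map_mul, SkewMonoidAlgebra.single_mul_single, one_smul,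
          one_mul] }
    { toFun := fun g => TensorProduct.map
        (Algebra.lsmul K K M (SkewMonoidAlgebra.single g (1 : A))) (ρ g)
      map_one' := by
        rw [← SkewMonoidAlgebra.one_def, map_one, map_one]
        exact TensorProduct.map_id
      map_mul' := fun g h => by
        rw [← TensorProduct.map_mul, ← map_mul, ← map_mul, SkewMonoidAlgebra.single_mul_single,
          smul_one, one_mul] }
    (by
      intro a g
      ext m w
      change (SkewMonoidAlgebra.single (1 : G) (g • a) • SkewMonoidAlgebra.single g (1 : A) • m)
          ⊗ₜ[K] ρ g w =
        (SkewMonoidAlgebra.single g (1 : A) • SkewMonoidAlgebra.single (1 : G) a • m) ⊗ₜ[K] ρ g w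
      rw [smul_smul, smul_smul, SkewMonoidAlgebra.single_mul_single,
        SkewMonoidAlgebra.single_mul_single]
      simp)

/-- The underlying group of the `A * G`-module `M ⊗_K W`. -/
def DiagTensor (_ : Representation K G W) : Type u := M ⊗[K] W

instance diagTensor_addCommGroup : AddCommGroup (DiagTensor M ρ) :=
  inferInstanceAs (AddCommGroup (M ⊗[K] W))

instance diagTensor_module : Module (SkewMonoidAlgebra A G) (DiagTensor M ρ) :=
  Module.compHom (M ⊗[K] W) (tensorHom M ρ)

/-- The element `m ⊗ w` of `M ⊗_K W`. -/
def diagTmul (m : M) (w : W) : DiagTensor M ρ := m ⊗ₜ[K] w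

theorem single_smul_diagTmul (g : G) (a : A) (m : M) (w : W) :
    SkewMonoidAlgebra.single g a • diagTmul M ρ m w =
      diagTmul M ρ (SkewMonoidAlgebra.single g a • m) (ρ g w) := by
  have h : tensorHom M ρ (SkewMonoidAlgebra.single g a) = _ :=
    SkewMonoidAlgebra.liftNC_single _ _ _ _
  change tensorHom M ρ (SkewMonoidAlgebra.single g a) (m ⊗ₜ[K] w) = _
  rw [h]
  change (SkewMonoidAlgebra.single (1 : G) a • SkewMonoidAlgebra.single g (1 : A) • m)
    ⊗ₜ[K] ρ g w = (SkewMonoidAlgebra.single g a • m) ⊗ₜ[K] ρ g w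
  rw [smul_smul, SkewMonoidAlgebra.single_mul_single]
  simp

/-- The `A * G`-module `M ⊗_K W`, with `(a g)(m ⊗ w) = (a g m) ⊗ (g w)`. -/
def diagTensor : ModuleCat.{u} (SkewMonoidAlgebra A G) := ModuleCat.of _ (DiagTensor M ρ)

end Tensor

/-- The component of degree `n` of the skew group algebra `E * G`, where `E` is the Yoneda algebra
of `X`: all coefficients are homogeneous of degree `n`. -/
def skewYonedaGrade (K : Type u) [Field K] [Algebra K A] [SMulCommClass G K A]
    (X : ModuleCat.{u} A) [DistribMulAction G X] [SMulDistribClass G A X] (n : ℕ) :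
    Submodule K (SkewMonoidAlgebra (YonedaAlgebra X) G) where
  carrier := {f | ∀ g : G, f.coeff g ∈ yonedaGrade K X n}
  zero_mem' := fun _ => zero_mem _
  add_mem' := fun {f f'} hf hf' g => by
    rw [SkewMonoidAlgebra.coeff_add]
    exact add_mem (hf g) (hf' g)
  smul_mem' := fun r f hf g => by
    rw [SkewMonoidAlgebra.coeff_smul]
    exact Submodule.smul_mem _ r (hf g)

end Skew

end YonedaExt

end

universe u

open YonedaExt

/-! Everything reduces to induced modules. Write Ind and Res for induction from `A` to `A * G` and
restriction back. Two identifications bring Ind in. The radical of `A * G` consists of the elements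
with all coefficients in `J = J(A)` (`ker_toIndTop`), so `(A * G)/J(A * G)` is Ind(A/J)
(`radQuotIso`). This is where the invertibility of |G| enters, through Maschke averaging. Moreover
`M ⊗ KG` is Ind(Res M), by g ⊗ m ↦ gm ⊗ g (`diagTensorIso`).

Let Y be an `A`-module with a compatible action of `G`. As an `A`-module, Res(Ind Y) is a direct sum
of twists of Y indexed by `G`, and the action identifies each twist with Y. Since Ind and Res are
exact and adjoint, Ext(Ind X, Ind Y) is a direct sum of copies of Ext(X, Y) indexed by `G`: every
class is uniquely a sum of classes Ind(α_g) R_g, where R_g is the endomorphism h ⊗ y ↦ hg ⊗ g⁻¹y of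
Ind Y (`extCoord_extInd`, `sum_extInd_extCoord`). Naturality of the twist gives R_g Ind(β) = Ind(gβ)
R_g, hence (Ind(α) R_g)(Ind(β) R_h) = Ind(α · gβ) R_{gh} (`extInd_comp`). This is the multiplication
of the skew group algebra, which yields (3) with its grading.

For (1), the same product formula shows that generation by Ext¹ passes between the pair (X, Y) and
the pair (Ind X, Ind Y) (`extGenerated_ind_iff`). For (2), a `G`-stable subspace V of an algebra
satisfies (V * G)^n = V^n * G for n ≥ 1 (`skewSubmodule_pow`), so E_i = (E_1)^i can be tested on
coefficients. -/

noncomputable section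

open CategoryTheory CategoryTheory.Limits
open CategoryTheory.Abelian (Ext)
open scoped DirectSum TensorProduct

universe w v

set_option linter.unusedSectionVars false

namespace YonedaExt

/-! ### Modules over the skew group algebra and induced modules -/

section SkewLinear

variable {A G : Type*} [Ring A] [Group G] [MulSemiringAction G A]

/-- An additive map commuting with the monomials `a g` is linear over the skew group algebra. -/
def skewLinearMap {M N : Type*} [AddCommGroup M] [AddCommGroup N]
    [Module (SkewMonoidAlgebra A G) M] [Module (SkewMonoidAlgebra A G) N] (f : M →+ N)
    (hf : ∀ (g : G) (a : A) (m : M),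
      f (SkewMonoidAlgebra.single g a • m) = SkewMonoidAlgebra.single g a • f m) :
    M →ₗ[SkewMonoidAlgebra A G] N where
  __ := f
  map_smul' s m := by
    change f (s • m) = s • f m
    induction s using SkewMonoidAlgebra.induction_on with
    | zero => simp
    | single g a => exact hf g a m
    | add s t hs ht => rw [add_smul, map_add, hs, ht, add_smul]

@[simp]
theorem skewLinearMap_apply {M N : Type*} [AddCommGroup M] [AddCommGroup N]
    [Module (SkewMonoidAlgebra A G) M] [Module (SkewMonoidAlgebra A G) N] (f : M →+ N)
    (hf : ∀ (g : G) (a : A) (m : M),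
      f (SkewMonoidAlgebra.single g a • m) = SkewMonoidAlgebra.single g a • f m) (m : M) :
    skewLinearMap f hf m = f m := rfl

end SkewLinear

section Induced

variable {A : Type*} (G : Type*) [Ring A] [Group G] [MulSemiringAction G A]

/-- The underlying group of the module induced from the `A`-module `X` to the skew group algebra
of a finite group: the function `f` stands for `∑ g, g ⊗ f g`. -/
def Induced (X : Type*) : Type _ := G → X

namespace Induced

variable {G} (X : Type*) [AddCommGroup X] [Module A X]

instance : AddCommGroup (Induced G X) := inferInstanceAs (AddCommGroup (G → X))

variable {X} in
@[ext]
theorem ext {f f' : Induced G X} (h : ∀ g : G, f g = f' g) : f = f' := funext h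

@[simp] theorem zero_apply (g : G) : (0 : Induced G X) g = 0 := rfl

variable {X} in
@[simp] theorem add_apply (f f' : Induced G X) (g : G) : (f + f') g = f g + f' g := rfl

variable (A G) in
/-- The ring homomorphism giving the action of the skew group algebra on the induced module. -/
def actionHom : SkewMonoidAlgebra A G →+* AddMonoid.End (Induced G X) :=
  SkewMonoidAlgebra.liftNCRingHom
    { toFun := fun a =>
        { toFun := fun f g => (g⁻¹ • a) • f g
          map_zero' := by ext g; exact smul_zero _
          map_add' := fun f f' => by ext g; exact smul_add _ _ _ }
      map_one' := by
        ext f g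
        change (g⁻¹ • (1 : A)) • f g = f g
        rw [smul_one, one_smul]
      map_zero' := by
        ext f g
        change (g⁻¹ • (0 : A)) • f g = 0
        rw [smul_zero, zero_smul]
      map_add' := fun a b => by
        ext f g
        change (g⁻¹ • (a + b)) • f g = (g⁻¹ • a) • f g + (g⁻¹ • b) • f g
        rw [smul_add, add_smul]
      map_mul' := fun a b => by
        ext f g
        change (g⁻¹ • (a * b)) • f g = (g⁻¹ • a) • (g⁻¹ • b) • f g
        rw [smul_mul', mul_smul] }
    { toFun := fun h =>
        { toFun := fun f g => f (h⁻¹ * g)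
          map_zero' := rfl
          map_add' := fun _ _ => rfl }
      map_one' := by
        ext f g
        change f (1⁻¹ * g) = f g
        rw [inv_one, one_mul]
      map_mul' := fun h k => by
        ext f g
        change f ((h * k)⁻¹ * g) = f (k⁻¹ * (h⁻¹ * g))
        rw [mul_inv_rev, mul_assoc] }
    (by
      intro a h
      ext f g
      change (g⁻¹ • h • a) • f (h⁻¹ * g) = ((h⁻¹ * g)⁻¹ • a) • f (h⁻¹ * g)
      rw [smul_smul, mul_inv_rev, inv_inv])

instance : Module (SkewMonoidAlgebra A G) (Induced G X) :=
  Module.compHom (Induced G X) (actionHom A G X)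

variable {X}

@[simp]
-- Moving `a` past the group element of g ⊗ x twists it: a(g ⊗ x) = g ⊗ g⁻¹(a)x. All later
-- computations in induced modules rest on this formula.
theorem single_smul_apply (h : G) (a : A) (f : Induced G X) (g : G) :
    (SkewMonoidAlgebra.single h a • f) g = (g⁻¹ • a) • f (h⁻¹ * g) := by
  have key : actionHom A G X (SkewMonoidAlgebra.single h a) = _ :=
    SkewMonoidAlgebra.liftNC_single _ _ _ _
  change actionHom A G X (SkewMonoidAlgebra.single h a) f g = _
  rw [key]
  rfl

theorem sum_apply {ι : Type*} (s : Finset ι) (f : ι → Induced G X) (g : G) :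
    (∑ i ∈ s, f i) g = ∑ i ∈ s, f i g :=
  Finset.sum_apply (M := fun _ => X) g s f

/-- The linear map between induced modules given by an `A`-linear map. -/
def map {Y : Type*} [AddCommGroup Y] [Module A Y] (φ : X →ₗ[A] Y) :
    Induced G X →ₗ[SkewMonoidAlgebra A G] Induced G Y :=
  skewLinearMap
    { toFun := fun f g => φ (f g)
      map_zero' := by ext g; exact map_zero φ
      map_add' := fun f f' => by ext g; exact map_add φ _ _ }
    (fun h a f => by
      ext g
      change φ ((SkewMonoidAlgebra.single h a • f) g) = _
      rw [single_smul_apply, map_smul, single_smul_apply]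
      rfl)

@[simp]
theorem map_apply {Y : Type*} [AddCommGroup Y] [Module A Y] (φ : X →ₗ[A] Y) (f : Induced G X)
    (g : G) : map φ f g = φ (f g) := rfl

variable [DecidableEq G]

variable (X) in
/-- The element `g ⊗ x` of the induced module. -/
def mk (g : G) : X →+ Induced G X where
  toFun x := Pi.single (M := fun _ => X) g x
  map_zero' := Pi.single_zero (M := fun _ => X) g
  map_add' := Pi.single_add (f := fun _ => X) g

theorem mk_apply (g : G) (x : X) (h : G) : mk X g x h = if h = g then x else 0 :=
  Pi.single_apply (M := X) g x h

@[simp]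
theorem single_smul_mk (h : G) (a : A) (g : G) (x : X) :
    SkewMonoidAlgebra.single h a • mk X g x = mk X (h * g) (((h * g)⁻¹ • a) • x) := by
  ext k
  rw [single_smul_apply, mk_apply, mk_apply]
  by_cases hk : k = h * g
  · subst hk
    simp
  · rw [if_neg hk, if_neg (fun h' => hk (by rw [← h', mul_inv_cancel_left])), smul_zero]

theorem eq_sum_mk [Fintype G] (f : Induced G X) : f = ∑ g : G, mk X g (f g) :=
  (Finset.univ_sum_single (M := fun _ => X) f).symm

theorem addHom_ext [Fintype G] {N : Type*} [AddCommMonoid N] {φ ψ : Induced G X →+ N}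
    (h : ∀ g x, φ (mk X g x) = ψ (mk X g x)) : φ = ψ := by
  ext f
  rw [eq_sum_mk f, map_sum, map_sum]
  exact Finset.sum_congr rfl fun g _ => h g _

theorem map_mk {Y : Type*} [AddCommGroup Y] [Module A Y] (φ : X →ₗ[A] Y) (g : G) (x : X) :
    map φ (mk X g x) = mk Y g (φ x) := by
  ext h
  rw [map_apply, mk_apply, mk_apply]
  split
  · rfl
  · exact map_zero φ

variable {N : Type*} [AddCommGroup N] [Module (SkewMonoidAlgebra A G) N] [Fintype G]

/-- The map from the induced module given by a map to the restriction of `N`,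
`g ⊗ x ↦ g φ(x)`. -/
def lift (φ : X →+ N)
    (hφ : ∀ (a : A) (x : X), φ (a • x) = SkewMonoidAlgebra.single (1 : G) a • φ x) :
    Induced G X →ₗ[SkewMonoidAlgebra A G] N :=
  skewLinearMap
    { toFun := fun f => ∑ g : G, SkewMonoidAlgebra.single g (1 : A) • φ (f g)
      map_zero' := by simp
      map_add' := fun f f' => by simp [Finset.sum_add_distrib] }
    (fun h a f => by
      change ∑ g : G, SkewMonoidAlgebra.single g (1 : A) •
          φ ((SkewMonoidAlgebra.single h a • f) g) =
        SkewMonoidAlgebra.single h a • ∑ g : G, SkewMonoidAlgebra.single g (1 : A) • φ (f g)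
      rw [Finset.smul_sum]
      refine (Fintype.sum_equiv (Equiv.mulLeft h) _ _ fun g => ?_).symm
      rw [single_smul_apply, Equiv.coe_mulLeft, inv_mul_cancel_left, smul_smul, hφ, smul_smul,
        SkewMonoidAlgebra.single_mul_single, SkewMonoidAlgebra.single_mul_single, smul_inv_smul,
        smul_one, mul_one, one_mul, mul_one])

theorem lift_mk (φ : X →+ N)
    (hφ : ∀ (a : A) (x : X), φ (a • x) = SkewMonoidAlgebra.single (1 : G) a • φ x) (g : G) (x : X) :
    lift φ hφ (mk X g x) = SkewMonoidAlgebra.single g (1 : A) • φ x := by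
  change ∑ h : G, SkewMonoidAlgebra.single h (1 : A) • φ (mk X g x h) = _
  rw [Finset.sum_eq_single g]
  · rw [mk_apply, if_pos rfl]
  · intro h _ hh
    rw [mk_apply, if_neg hh, map_zero, smul_zero]
  · simp

theorem linearMap_ext {φ ψ : Induced G X →ₗ[SkewMonoidAlgebra A G] N}
    (h : ∀ g x, φ (mk X g x) = ψ (mk X g x)) : φ = ψ :=
  LinearMap.toAddMonoidHom_injective (addHom_ext h)

end Induced

end Induced

/-! ### Exactness and adjunction of induction and restriction -/

section Functor

variable (A G : Type u) [Ring A] [Group G] [MulSemiringAction G A]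

/-- Induction of modules from `A` to the skew group algebra of a finite group. -/
def ind : ModuleCat.{u} A ⥤ ModuleCat.{u} (SkewMonoidAlgebra A G) where
  obj X := ModuleCat.of _ (Induced G X)
  map f := ModuleCat.ofHom (Induced.map f.hom)

/-- Restriction of modules from the skew group algebra to `A`. -/
abbrev res : ModuleCat.{u} (SkewMonoidAlgebra A G) ⥤ ModuleCat.{u} A :=
  ModuleCat.restrictScalars (SkewMonoidAlgebra.singleOneRingHom (k := A) (G := G))

instance ind_additive : (ind A G).Additive where
  map_add := rfl

/-- On underlying groups induction is the product of copies indexed by `G`, so exactness is checked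
componentwise, with one preimage chosen for each g. -/
theorem ind_map_exact (T : ShortComplex (ModuleCat.{u} A)) (h : T.Exact) :
    (T.map (ind A G)).Exact := by
  rw [CategoryTheory.ShortComplex.ShortExact.moduleCat_exact_iff_function_exact] at h ⊢
  intro f
  constructor
  · intro hf
    choose x hx using fun g : G => (h ((show Induced G T.X₂ from f) g)).mp (congrFun hf g)
    exact ⟨x, funext hx⟩
  · rintro ⟨x, rfl⟩
    funext g
    exact (h _).mpr ⟨_, rfl⟩

instance ind_preservesFiniteLimits : PreservesFiniteLimits (ind A G) :=
  (((Functor.exact_tfae (ind A G)).out 1 3 (a := ∀ S : ShortComplex (ModuleCat.{u} A), S.Exact →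
    (S.map (ind A G)).Exact) (b := PreservesFiniteLimits (ind A G) ∧
    PreservesFiniteColimits (ind A G))).mp (ind_map_exact A G)).1

instance ind_preservesFiniteColimits : PreservesFiniteColimits (ind A G) :=
  (((Functor.exact_tfae (ind A G)).out 1 3 (a := ∀ S : ShortComplex (ModuleCat.{u} A), S.Exact →
    (S.map (ind A G)).Exact) (b := PreservesFiniteLimits (ind A G) ∧
    PreservesFiniteColimits (ind A G))).mp (ind_map_exact A G)).2

instance res_preservesFiniteLimits : PreservesFiniteLimits (res A G) :=
  (((Functor.exact_tfae (res A G)).out 1 3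
    (a := ∀ S : ShortComplex (ModuleCat.{u} (SkewMonoidAlgebra A G)), S.Exact →
    (S.map (res A G)).Exact) (b := PreservesFiniteLimits (res A G) ∧
    PreservesFiniteColimits (res A G))).mp (restrictScalars_map_exact _)).1

instance res_preservesFiniteColimits : PreservesFiniteColimits (res A G) :=
  (((Functor.exact_tfae (res A G)).out 1 3
    (a := ∀ S : ShortComplex (ModuleCat.{u} (SkewMonoidAlgebra A G)), S.Exact →
    (S.map (res A G)).Exact) (b := PreservesFiniteLimits (res A G) ∧
    PreservesFiniteColimits (res A G))).mp (restrictScalars_map_exact _)).2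

theorem algebraMap_skew {K : Type*} [CommSemiring K] [Algebra K A] [SMulCommClass G K A] (r : K) :
    algebraMap K (SkewMonoidAlgebra A G) r = SkewMonoidAlgebra.single 1 (algebraMap K A r) := by
  rw [SkewMonoidAlgebra.coe_algebraMap]
  rfl

/-- `G` fixes the scalars from `K`, so the twist by g⁻¹ in the component at g leaves them unchanged.
-/
instance ind_linear (K : Type u) [Field K] [Algebra K A] [SMulCommClass G K A] :
    (ind A G).Linear K where
  map_smul {X Y} f r := by
    ext x
    refine Induced.ext fun g => ?_
    change algebraMap K A r • f.hom ((show Induced G X from x) g) =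
      (algebraMap K (SkewMonoidAlgebra A G) r • (Induced.map f.hom x : Induced G Y)) g
    rw [algebraMap_skew, Induced.single_smul_apply, smul_algebraMap, inv_one, one_mul]
    rfl

variable [DecidableEq G]

/-- The unit of the adjunction between induction and restriction, `x ↦ 1 ⊗ x`. -/
def indUnit : 𝟭 (ModuleCat.{u} A) ⟶ ind A G ⋙ res A G where
  app X := ModuleCat.ofHom (X := X) (Y := (res A G).obj ((ind A G).obj X))
    { __ := Induced.mk (G := G) X 1
      map_smul' := fun a x => by
        change Induced.mk X 1 (a • x) =
          (SkewMonoidAlgebra.single (1 : G) a • Induced.mk X 1 x : Induced G X)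
        rw [Induced.single_smul_mk, mul_one, inv_one, one_smul] }
  naturality X Y f := by
    ext x
    refine Induced.ext fun g => ?_
    change Induced.mk Y 1 (f.hom x) g = f.hom (Induced.mk X (1 : G) x g)
    rw [Induced.mk_apply, Induced.mk_apply]
    split <;> simp

variable [Fintype G]

/-- The counit of the adjunction between induction and restriction, `g ⊗ x ↦ g x`. -/
def indCounit : res A G ⋙ ind A G ⟶ 𝟭 (ModuleCat.{u} (SkewMonoidAlgebra A G)) where
  app N := ModuleCat.ofHom (X := (ind A G).obj ((res A G).obj N)) (Y := N)
    (Induced.lift (X := (res A G).obj N) (N := N) (AddMonoidHom.id N) fun _ _ => rfl)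
  naturality M N f := by
    ext x
    change ∑ g : G, SkewMonoidAlgebra.single g (1 : A) • f.hom (show M from x g) =
      f.hom (∑ g : G, SkewMonoidAlgebra.single g (1 : A) • (show M from x g))
    rw [map_sum]
    exact Finset.sum_congr rfl fun g _ => (map_smul f.hom _ _).symm

variable {A G} in
theorem ind_hom_ext {X : ModuleCat.{u} A} {N : ModuleCat.{u} (SkewMonoidAlgebra A G)}
    {φ ψ : (ind A G).obj X ⟶ N}
    (h : ∀ (g : G) (x : X), φ.hom (Induced.mk X g x) = ψ.hom (Induced.mk X g x)) : φ = ψ :=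
  ModuleCat.hom_ext (Induced.linearMap_ext h)

/-- This triangle identity is what makes the adjunction map on Ext injective. -/
theorem indCounit_unit (X : ModuleCat.{u} A) :
    (ind A G).map ((indUnit A G).app X) ≫ (indCounit A G).app ((ind A G).obj X) = 𝟙 _ := by
  refine ind_hom_ext fun g x => ?_
  have h₁ : ((ind A G).map ((indUnit A G).app X)).hom (Induced.mk X g x) =
      Induced.mk ((res A G).obj ((ind A G).obj X)) g (Induced.mk X (1 : G) x) :=
    Induced.map_mk ((indUnit A G).app X).hom g x
  have h₂ : ((indCounit A G).app ((ind A G).obj X)).hom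
      (Induced.mk ((res A G).obj ((ind A G).obj X)) g (Induced.mk X (1 : G) x)) =
      (SkewMonoidAlgebra.single g (1 : A) • Induced.mk X 1 x : Induced G X) :=
    Induced.lift_mk (X := (res A G).obj ((ind A G).obj X)) (N := Induced G X)
      (AddMonoidHom.id (Induced G X)) (fun _ _ => rfl) g _
  have h₃ : (SkewMonoidAlgebra.single g (1 : A) • Induced.mk X 1 x : Induced G X) =
      Induced.mk X g x := by
    rw [Induced.single_smul_mk, mul_one, smul_one, one_smul]
  exact (congrArg ((indCounit A G).app ((ind A G).obj X)).hom h₁).trans (h₂.trans h₃)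

end Functor

/-! ### Ext between induced modules -/

section InducedExt

variable {A G : Type u} [Ring A] [Group G] [MulSemiringAction G A]

variable (A) in
/-- The natural isomorphism from the module induced from the twist of `X` by `g` to the module
induced from `X`, given by `h ⊗ x ↦ h g ⊗ x`. -/
def indTwist (g : G) : twist A g ⋙ ind A G ⟶ ind A G where
  app X := ModuleCat.ofHom (X := (ind A G).obj ((twist A g).obj X)) (Y := (ind A G).obj X) <|
    skewLinearMap (M := Induced G ((twist A g).obj X)) (N := Induced G X)
      { toFun := fun f k => f (k * g⁻¹)
        map_zero' := rfl
        map_add' := fun _ _ => rfl }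
      (fun h a f => by
        refine Induced.ext fun k => ?_
        have h₁ := Induced.single_smul_apply (X := (twist A g).obj X) h a f (k * g⁻¹)
        have h₂ := Induced.single_smul_apply (X := X) h a (fun k => f (k * g⁻¹)) k
        refine h₁.trans (Eq.trans ?_ h₂.symm)
        change (g⁻¹ • (k * g⁻¹)⁻¹ • a) • (show X from f (h⁻¹ * (k * g⁻¹))) =
          (k⁻¹ • a) • (show X from f (h⁻¹ * k * g⁻¹))
        rw [smul_smul, mul_inv_rev, inv_inv, inv_mul_cancel_left, mul_assoc])

section

variable (Y : ModuleCat.{u} A) [DistribMulAction G Y] [SMulDistribClass G A Y]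

/-- The endomorphism `h ⊗ y ↦ h g ⊗ g⁻¹ y` of the module induced from `Y`. -/
def indRight (g : G) : (ind A G).obj Y ⟶ (ind A G).obj Y :=
  (ind A G).map (toTwist Y g) ≫ (indTwist A g).app Y

theorem indRight_apply (g : G) (f : Induced G Y) (k : G) :
    (show Induced G Y from (indRight Y g).hom f) k = g⁻¹ • f (k * g⁻¹) := rfl

theorem indRight_one : indRight Y (1 : G) = 𝟙 _ := by
  ext f
  refine Induced.ext fun k => (indRight_apply Y 1 f k).trans ?_
  rw [inv_one, one_smul, mul_one]
  rfl

theorem indRight_mul (g h : G) : indRight Y g ≫ indRight Y h = indRight Y (g * h) := by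
  ext f
  refine Induced.ext fun k => Eq.trans ?_ (indRight_apply Y (g * h) f k).symm
  change h⁻¹ • g⁻¹ • (show Induced G Y from f) (k * h⁻¹ * g⁻¹) = _
  rw [mul_inv_rev, mul_smul, mul_assoc]

variable {Y} in
-- This is the source of the skew relation ga = g(a)g. The map `indTwist` is natural, hence natural
-- on Ext, and the identifications of the ends with their twists are exactly those in the definition
-- of `extAct`.
theorem indRight_comp_ind {X : ModuleCat.{u} A} [DistribMulAction G X] [SMulDistribClass G A X]
    (g : G) {n : ℕ} (α : Ext X Y n) :
    (Ext.mk₀ (indRight X g)).comp (α.mapExactFunctor (ind A G)) (zero_add n) =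
      ((extAct X Y g n α).mapExactFunctor (ind A G)).comp (Ext.mk₀ (indRight Y g))
        (add_zero n) := by
  have nat := mapExactFunctor_natTrans _ _ (indTwist A g) α
  rw [mapExactFunctor_functor_comp] at nat
  have hY : (ind A G).map (fromTwist Y g) ≫ indRight Y g = (indTwist A g).app Y := by
    rw [indRight, ← Category.assoc, ← CategoryTheory.Functor.map_comp, fromTwist_toTwist,
      CategoryTheory.Functor.map_id]
    exact Category.id_comp _
  rw [extAct_def, Ext.mapExactFunctor_comp, Ext.mapExactFunctor_comp, Ext.mapExactFunctor_mk₀,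
    Ext.mapExactFunctor_mk₀, Ext.comp_assoc_of_third_deg_zero, Ext.comp_assoc_of_third_deg_zero,
    Ext.mk₀_comp_mk₀, hY, indRight, ← Ext.mk₀_comp_mk₀_assoc]
  exact congrArg (fun z => (Ext.mk₀ _).comp z (zero_add n)) nat.symm

end

variable [DecidableEq G] [Fintype G]

/-- The map `Ext(Ind X, N) → Ext(X, Res N)` of the adjunction between induction and restriction. -/
def extAdj {X : ModuleCat.{u} A} {N : ModuleCat.{u} (SkewMonoidAlgebra A G)} {n : ℕ} :
    Ext ((ind A G).obj X) N n →+ Ext X ((res A G).obj N) n where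
  toFun ξ := (Ext.mk₀ ((indUnit A G).app X)).comp (ξ.mapExactFunctor (res A G)) (zero_add n)
  map_zero' := by simp
  map_add' := by simp

theorem extAdj_apply {X : ModuleCat.{u} A} {N : ModuleCat.{u} (SkewMonoidAlgebra A G)} {n : ℕ}
    (ξ : Ext ((ind A G).obj X) N n) : extAdj ξ =
      (Ext.mk₀ ((indUnit A G).app X)).comp (ξ.mapExactFunctor (res A G)) (zero_add n) := rfl

/-- Inducing and then applying the counit is a left inverse, by naturality of the counit on Ext and
the triangle identity. -/
theorem extAdj_injective {X : ModuleCat.{u} A} {N : ModuleCat.{u} (SkewMonoidAlgebra A G)} {n : ℕ} :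
    Function.Injective (extAdj (X := X) (N := N) (n := n)) := by
  refine Function.LeftInverse.injective
    (g := fun β => (β.mapExactFunctor (ind A G)).comp (Ext.mk₀ ((indCounit A G).app N))
      (add_zero n)) fun ξ => ?_
  have nat := mapExactFunctor_natTrans _ _ (indCounit A G) ξ
  rw [mapExactFunctor_functor_comp, mapExactFunctor_id] at nat
  have tri := congrArg Ext.mk₀ (indCounit_unit A G X)
  rw [← Ext.mk₀_comp_mk₀] at tri
  dsimp only
  rw [extAdj_apply, Ext.mapExactFunctor_comp, Ext.mapExactFunctor_mk₀,
    Ext.comp_assoc_of_third_deg_zero]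
  refine (congrArg (fun z => (Ext.mk₀ ((ind A G).map ((indUnit A G).app X))).comp z (zero_add n))
    nat).trans ?_
  rw [← Ext.comp_assoc_of_second_deg_zero]
  refine (congrArg (fun z => Ext.comp z ξ (zero_add n)) tri).trans ?_
  exact Ext.mk₀_id_comp ξ

/-- Naturality of the unit on Ext moves it from X past α to Y. -/
theorem extAdj_ind_comp {X Y : ModuleCat.{u} A} {N : ModuleCat.{u} (SkewMonoidAlgebra A G)} {n : ℕ}
    (α : Ext X Y n) (f : (ind A G).obj Y ⟶ N) :
    extAdj ((α.mapExactFunctor (ind A G)).comp (Ext.mk₀ f) (add_zero n)) =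
      α.comp (Ext.mk₀ ((indUnit A G).app Y ≫ (res A G).map f)) (add_zero n) := by
  have nat := mapExactFunctor_natTrans _ _ (indUnit A G) α
  rw [mapExactFunctor_functor_comp, mapExactFunctor_id] at nat
  rw [extAdj_apply, Ext.mapExactFunctor_comp, Ext.mapExactFunctor_mk₀, ← Ext.mk₀_comp_mk₀,
    ← Ext.comp_assoc_of_third_deg_zero, ← Ext.comp_assoc_of_third_deg_zero]
  exact congrArg (fun z => Ext.comp z _ (add_zero n)) nat.symm

variable {X : ModuleCat.{u} A} (Y : ModuleCat.{u} A) [DistribMulAction G Y]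
  [SMulDistribClass G A Y]

/-- The projection `h ⊗ y ↦ δ_{g h} h y` of the restriction of the induced module to `Y`. -/
def indProj (g : G) : (res A G).obj ((ind A G).obj Y) ⟶ Y :=
  ModuleCat.ofHom (X := (res A G).obj ((ind A G).obj Y)) (Y := Y)
    { toFun := fun f => g • (show Induced G Y from f) g
      map_add' := fun f f' => smul_add g ((show Induced G Y from f) g) _
      map_smul' := fun a f => by
        change g • ((SkewMonoidAlgebra.single (1 : G) a • (show Induced G Y from f) :
          Induced G Y) g) = a • g • (show Induced G Y from f) g
        rw [Induced.single_smul_apply, smul_distrib_smul, smul_inv_smul, inv_one, one_mul] }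

/-- The inclusion `y ↦ g ⊗ g⁻¹ y`. -/
def indIncl (g : G) : Y ⟶ (res A G).obj ((ind A G).obj Y) :=
  (indUnit A G).app Y ≫ (res A G).map (indRight Y g)

theorem indIncl_apply (g : G) (y : Y) : (indIncl Y g).hom y = Induced.mk Y g (g⁻¹ • y) := by
  refine Induced.ext fun k => ?_
  change g⁻¹ • Induced.mk Y 1 y (k * g⁻¹) = _
  rw [Induced.mk_apply, Induced.mk_apply]
  simp only [mul_inv_eq_one]
  split
  · rfl
  · exact smul_zero _

/-- The subgroup g ⊗ Y is the twist of Y by g, and y ↦ g ⊗ g⁻¹y identifies Y with it. Together with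
`sum_indProj_incl` this exhibits Res(Ind Y) as a biproduct of copies of Y. -/
theorem indIncl_proj (g h : G) : indIncl Y g ≫ indProj Y h = if g = h then 𝟙 Y else 0 := by
  ext y
  have : (indIncl Y g ≫ indProj Y h).hom y = h • Induced.mk Y g (g⁻¹ • y) h :=
    congrArg (fun f : Induced G Y => h • f h) (indIncl_apply Y g y)
  rw [this, Induced.mk_apply]
  by_cases hgh : g = h
  · subst hgh
    rw [if_pos rfl, if_pos rfl, smul_inv_smul]
    rfl
  · rw [if_neg hgh, if_neg (fun h' => hgh h'.symm), smul_zero]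
    rfl

theorem sum_indProj_incl : ∑ g : G, indProj Y g ≫ indIncl Y g = 𝟙 _ := by
  ext f
  rw [ModuleCat.hom_sum, LinearMap.sum_apply]
  refine Eq.trans ?_ (Induced.eq_sum_mk (X := Y) f).symm
  refine Finset.sum_congr rfl fun g _ => ?_
  refine (indIncl_apply Y g (g • (show Induced G Y from f) g)).trans ?_
  rw [inv_smul_smul]

variable {Y} {n : ℕ}

/-- The component at `g` of an element of `Ext(Ind X, Ind Y)`. -/
def extCoord (g : G) : Ext ((ind A G).obj X) ((ind A G).obj Y) n →+ Ext X Y n where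
  toFun ξ := (extAdj ξ).comp (Ext.mk₀ (indProj Y g)) (add_zero n)
  map_zero' := by simp
  map_add' := by simp

theorem extCoord_apply (g : G) (ξ : Ext ((ind A G).obj X) ((ind A G).obj Y) n) :
    extCoord g ξ = (extAdj ξ).comp (Ext.mk₀ (indProj Y g)) (add_zero n) := rfl

variable (X Y n) in
/-- The map `Ext(X, Y) → Ext(Ind X, Ind Y)` inducing `α` and then applying the right
multiplication by `g`. -/
def extInd (g : G) : Ext X Y n →+ Ext ((ind A G).obj X) ((ind A G).obj Y) n where
  toFun α := (α.mapExactFunctor (ind A G)).comp (Ext.mk₀ (indRight Y g)) (add_zero n)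
  map_zero' := by simp
  map_add' := by simp

theorem extInd_apply (g : G) (α : Ext X Y n) : extInd X Y n g α =
    (α.mapExactFunctor (ind A G)).comp (Ext.mk₀ (indRight Y g)) (add_zero n) := rfl

theorem extCoord_extInd (g h : G) (α : Ext X Y n) :
    extCoord h (extInd X Y n g α) = if g = h then α else 0 := by
  rw [extCoord_apply, extInd_apply, extAdj_ind_comp, Ext.comp_assoc_of_third_deg_zero,
    Ext.mk₀_comp_mk₀]
  change α.comp (Ext.mk₀ (indIncl Y g ≫ indProj Y h)) _ = _
  rw [indIncl_proj]
  split
  · exact Ext.comp_mk₀_id α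
  · simp

/-- After the injective map `extAdj`, this is the resolution of the identity of Res(Ind Y) into its
summands. With `extCoord_extInd` it gives existence and uniqueness of the coordinates. -/
theorem sum_extInd_extCoord (ξ : Ext ((ind A G).obj X) ((ind A G).obj Y) n) :
    ∑ g : G, extInd X Y n g (extCoord g ξ) = ξ := by
  refine extAdj_injective ?_
  rw [map_sum]
  have h : ∀ g : G, extAdj (extInd X Y n g (extCoord g ξ)) =
      (extAdj ξ).comp (Ext.mk₀ (indProj Y g ≫ indIncl Y g)) (add_zero n) := fun g => by
    rw [extInd_apply, extAdj_ind_comp, extCoord_apply, Ext.comp_assoc_of_third_deg_zero,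
      Ext.mk₀_comp_mk₀]
    rfl
  rw [Finset.sum_congr rfl fun g _ => h g, ← Ext.comp_sum, ← Ext.mk₀_sum, sum_indProj_incl]
  exact Ext.comp_mk₀_id _

/-- Moving R_g past Ind(β) replaces β by gβ, and then R_g R_h = R_{gh}: the multiplication rule of a
skew group algebra. -/
theorem extInd_comp {Z : ModuleCat.{u} A} [DistribMulAction G Z] [SMulDistribClass G A Z]
    {a b c : ℕ} (g h : G) (α : Ext X Y a) (β : Ext Y Z b) (habc : a + b = c) :
    (extInd X Y a g α).comp (extInd Y Z b h β) habc =
      extInd X Z c (g * h) (α.comp (extAct Y Z g b β) habc) := by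
  rw [extInd_apply, extInd_apply, extInd_apply, ← indRight_mul, ← Ext.mk₀_comp_mk₀,
    Ext.mapExactFunctor_comp, Ext.comp_assoc_of_second_deg_zero,
    ← Ext.comp_assoc_of_third_deg_zero (Ext.mk₀ (indRight Y g)), indRight_comp_ind,
    Ext.comp_assoc_of_third_deg_zero, Ext.comp_assoc_of_third_deg_zero]

theorem extInd_smul {K : Type u} [Field K] [Algebra K A] [SMulCommClass G K A] (g : G) (r : K)
    (α : Ext X Y n) : extInd X Y n g (r • α) = r • extInd X Y n g α := by
  simp [extInd_apply]

end InducedExt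

/-! ### The radical of the skew group algebra -/

section Radical

open SkewMonoidAlgebra (single)

variable {A G : Type u} [Ring A] [Group G] [MulSemiringAction G A]

/-- A module over a skew group algebra is semisimple if it is so over the coefficient ring and the
order of the group is invertible by a central invariant element. -/
theorem isSemisimpleModule_skew [Fintype G] (c : A) (hcomm : ∀ a : A, a * c = c * a)
    (hfix : ∀ g : G, g • c = c) (hcard : (Fintype.card G : A) * c = 1) {N : Type*} [AddCommGroup N]
    [Module (SkewMonoidAlgebra A G) N] [Module A N]
    (hN : ∀ (a : A) (n : N), a • n = single (1 : G) a • n) [IsSemisimpleModule A N] :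
    IsSemisimpleModule (SkewMonoidAlgebra A G) N := by
  refine IsSemisimpleModule.mk (toComplementedLattice := ⟨fun P => ?_⟩)
  let PA : Submodule A N :=
    { P.toAddSubmonoid with
      smul_mem' := fun a n hn => by
        rw [hN]
        exact P.smul_mem _ hn }
  obtain ⟨Q, hQ⟩ := exists_isCompl PA
  let π : N →ₗ[A] PA := PA.projectionOnto Q hQ
  -- Maschke averaging: with c = 1/|G|, the map c ∑ g π g⁻¹ turns an `A`-linear projection onto P
  -- into one that is linear over the skew group algebra.
  let avg : N →+ P :=
    { toFun := fun n => ∑ g : G,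
        (single g c : SkewMonoidAlgebra A G) • (⟨π (single g⁻¹ (1 : A) • n), (π _).2⟩ : P)
      map_zero' := by
        refine Finset.sum_eq_zero fun g _ => ?_
        ext
        simp
      map_add' := fun n n' => by
        rw [← Finset.sum_add_distrib]
        refine Finset.sum_congr rfl fun g _ => ?_
        rw [← smul_add]
        congr 1
        ext
        simp }
  have coe_avg : ∀ n, (avg n : N) =
      ∑ g : G, (single g c : SkewMonoidAlgebra A G) • (π (single g⁻¹ (1 : A) • n) : N) := fun n => by
    change ((∑ g : G, (single g c : SkewMonoidAlgebra A G) •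
      (⟨π (single g⁻¹ (1 : A) • n), (π _).2⟩ : P) : P) : N) = _
    rw [Submodule.coe_sum]
    rfl
  refine ⟨_, LinearMap.isCompl_of_proj (f := skewLinearMap avg fun h a n => ?_) fun p => ?_⟩
  · ext
    rw [Submodule.coe_smul, coe_avg, coe_avg, Finset.smul_sum]
    refine (Fintype.sum_equiv (Equiv.mulLeft h) _ _ fun k => ?_).symm
    -- In the summand at hk the coefficient a becomes (hk)⁻¹(a). It passes through the `A`-linear
    -- map π, and the outer factor hk turns it back into a.
    have h₁ : single (h * k)⁻¹ (1 : A) • single h a • n =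
        ((h * k)⁻¹ • a) • single k⁻¹ (1 : A) • n := by
      rw [hN, smul_smul, smul_smul, SkewMonoidAlgebra.single_mul_single,
        SkewMonoidAlgebra.single_mul_single, one_smul, one_mul, one_mul, mul_one, mul_inv_rev,
        inv_mul_cancel_right]
    have h₂ : (π (((h * k)⁻¹ • a) • single k⁻¹ (1 : A) • n) : N) =
        single (1 : G) ((h * k)⁻¹ • a) • (π (single k⁻¹ (1 : A) • n) : N) := by
      rw [π.map_smul, Submodule.coe_smul, hN]
    rw [Equiv.coe_mulLeft, h₁, h₂, smul_smul, smul_smul,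
      SkewMonoidAlgebra.single_mul_single, SkewMonoidAlgebra.single_mul_single, smul_inv_smul,
      mul_one, hfix, hcomm]
  · ext
    rw [skewLinearMap_apply, coe_avg]
    -- P is stable under `G`, so π fixes g⁻¹p. Each of the |G| summands is therefore cp.
    have h₁ : ∀ g : G, (single g c : SkewMonoidAlgebra A G) • (π (single g⁻¹ (1 : A) • (p : N)) : N) =
        single (1 : G) c • (p : N) := fun g => by
      have h₂ : (π (single g⁻¹ (1 : A) • (p : N)) : N) = single g⁻¹ (1 : A) • (p : N) :=
        congrArg Subtype.val (Submodule.projectionOnto_apply_left hQ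
          ⟨single g⁻¹ (1 : A) • (p : N), P.smul_mem _ p.2⟩)
      rw [h₂, smul_smul, SkewMonoidAlgebra.single_mul_single, smul_one, mul_one, mul_inv_cancel]
    rw [Finset.sum_congr rfl fun g _ => h₁ g, Finset.sum_const, Finset.card_univ, ← hN,
      ← Nat.cast_smul_eq_nsmul A, smul_smul, hcard, one_smul]

theorem smul_mem_jacobson (g : G) {a : A} (ha : a ∈ Ring.jacobson A) : g • a ∈ Ring.jacobson A :=
  Ring.le_comap_jacobson (MulSemiringAction.toRingHom G A g) ha

/-- The radical of `A` is stable under automorphisms, so the twist in the product does not leave it.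
Hence powers of J bound the coefficients of powers of an element. -/
theorem coeff_mul_mem_jacobson_pow {n : ℕ} {s t : SkewMonoidAlgebra A G}
    (hs : ∀ g, s.coeff g ∈ Ring.jacobson A ^ n) (ht : ∀ g, t.coeff g ∈ Ring.jacobson A) (g : G) :
    (s * t).coeff g ∈ Ring.jacobson A ^ (n + 1) := by
  rw [SkewMonoidAlgebra.coeff_mul_left, SkewMonoidAlgebra.sum_def, Submodule.pow_succ]
  exact Submodule.sum_mem _ fun h _ => Ideal.mul_mem_mul (hs h) (smul_mem_jacobson h (ht _))

theorem coeff_mul_mem_jacobson (s : SkewMonoidAlgebra A G) {t : SkewMonoidAlgebra A G}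
    (ht : ∀ g, t.coeff g ∈ Ring.jacobson A) (g : G) : (s * t).coeff g ∈ Ring.jacobson A := by
  rw [SkewMonoidAlgebra.coeff_mul_left, SkewMonoidAlgebra.sum_def]
  exact Submodule.sum_mem _ fun h _ => Ideal.mul_mem_left _ _ (smul_mem_jacobson h (ht _))

theorem isNilpotent_of_coeff_mem_jacobson [IsSemiprimaryRing A] {s : SkewMonoidAlgebra A G}
    (hs : ∀ g, s.coeff g ∈ Ring.jacobson A) : IsNilpotent s := by
  obtain ⟨n, hn⟩ := IsSemiprimaryRing.isNilpotent (R := A)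
  have key : ∀ (k : ℕ) (g : G), (s ^ k).coeff g ∈ Ring.jacobson A ^ k := fun k => by
    induction k with
    | zero => intro g; rw [Submodule.pow_zero, Ideal.one_eq_top]; exact Submodule.mem_top
    | succ k ih => intro g; rw [pow_succ]; exact coeff_mul_mem_jacobson_pow ih hs g
  refine ⟨n, SkewMonoidAlgebra.ext fun g => ?_⟩
  have := key n g
  rw [hn] at this
  exact this

/-- The elements with coefficients in J form a left ideal of nilpotent elements, so 1 + ys is
invertible for every y. -/
theorem mem_jacobson_of_coeff_mem [IsSemiprimaryRing A] {s : SkewMonoidAlgebra A G}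
    (hs : ∀ g, s.coeff g ∈ Ring.jacobson A) : s ∈ Ring.jacobson (SkewMonoidAlgebra A G) := by
  rw [← Ideal.jacobson_bot, Ideal.mem_jacobson_iff]
  intro y
  obtain ⟨z, hz⟩ := (isNilpotent_of_coeff_mem_jacobson
    (coeff_mul_mem_jacobson y hs)).isUnit_add_one.exists_left_inv
  refine ⟨z, ?_⟩
  rw [Ideal.mem_bot, mul_assoc, sub_eq_zero, ← hz, mul_add, mul_one]

theorem isSemisimpleModule_quotient_jacobson [IsArtinianRing A] :
    IsSemisimpleModule A (A ⧸ Ring.jacobson A) :=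
  (IsArtinian.isSemisimpleModule_iff_jacobson A _).mpr (Module.jacobson_quotient_jacobson A A)

/-- Over `A` the induced module embeds in a finite power of Y, so it is semisimple there. Maschke's
argument lifts this to the skew group algebra. -/
theorem isSemisimpleModule_ind [Fintype G] [DecidableEq G] (c : A) (hcomm : ∀ a : A, a * c = c * a)
    (hfix : ∀ g : G, g • c = c) (hcard : (Fintype.card G : A) * c = 1) (Y : ModuleCat.{u} A)
    [DistribMulAction G Y] [SMulDistribClass G A Y] [IsSemisimpleModule A Y] :
    IsSemisimpleModule (SkewMonoidAlgebra A G) (Induced G Y) := by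
  have inj : Function.Injective (LinearMap.pi fun g : G => (indProj Y g).hom) := fun f f' h =>
    Induced.ext fun g => smul_left_cancel g (congrFun h g)
  have : IsSemisimpleModule A ((res A G).obj ((ind A G).obj Y)) :=
    IsSemisimpleModule.of_injective _ inj
  exact isSemisimpleModule_skew (N := (res A G).obj ((ind A G).obj Y)) c hcomm hfix hcard
    fun a n => rfl

variable (A G) in
/-- The map from the skew group algebra to the module induced from `A / J`, with kernel the
Jacobson radical of the skew group algebra. -/
def toIndTop [DecidableEq G] :
    SkewMonoidAlgebra A G →ₗ[SkewMonoidAlgebra A G] Induced G (A ⧸ Ring.jacobson A) :=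
  LinearMap.toSpanSingleton _ _ (Induced.mk _ 1 (Submodule.Quotient.mk 1))

theorem toIndTop_single [DecidableEq G] (h : G) (a : A) :
    toIndTop A G (single h a) =
      Induced.mk (A ⧸ Ring.jacobson A) h (Submodule.Quotient.mk (h⁻¹ • a)) := by
  rw [toIndTop, LinearMap.toSpanSingleton_apply, Induced.single_smul_mk, mul_one,
    ← Submodule.Quotient.mk_smul, smul_eq_mul, mul_one]

theorem toIndTop_apply [DecidableEq G] (s : SkewMonoidAlgebra A G) (g : G) :
    toIndTop A G s g = Submodule.Quotient.mk (g⁻¹ • s.coeff g) := by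
  induction s using SkewMonoidAlgebra.induction_on with
  | zero => simp
  | single h a =>
    rw [toIndTop_single, Induced.mk_apply, SkewMonoidAlgebra.coeff_single, Finsupp.single_apply]
    by_cases hg : g = h
    · subst hg; simp
    · rw [if_neg hg, if_neg (fun h' => hg h'.symm), smul_zero, Submodule.Quotient.mk_zero]
  | add s t hs ht =>
    rw [map_add, Induced.add_apply, hs, ht, SkewMonoidAlgebra.coeff_add, Finsupp.add_apply,
      smul_add, Submodule.Quotient.mk_add]

theorem toIndTop_surjective [DecidableEq G] [Fintype G] : Function.Surjective (toIndTop A G) := by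
  intro f
  choose a ha using fun g => Submodule.Quotient.mk_surjective (Ring.jacobson A) (f g)
  refine ⟨∑ g : G, single g (g • a g), ?_⟩
  rw [map_sum, Induced.eq_sum_mk f]
  refine Finset.sum_congr rfl fun g _ => ?_
  rw [toIndTop_single, inv_smul_smul, ha]

/-- By `toIndTop_apply` the kernel consists of the elements with coefficients in J, which lie in the
radical. Conversely the target is semisimple, so the radical maps to zero. -/
theorem ker_toIndTop [DecidableEq G] [Fintype G] [IsArtinianRing A] (c : A)
    (hcomm : ∀ a : A, a * c = c * a) (hfix : ∀ g : G, g • c = c)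
    (hcard : (Fintype.card G : A) * c = 1) :
    LinearMap.ker (toIndTop A G) = Ring.jacobson (SkewMonoidAlgebra A G) := by
  refine le_antisymm (fun s hs => mem_jacobson_of_coeff_mem fun g => ?_) ?_
  · have h := congrArg (fun f : Induced G (A ⧸ Ring.jacobson A) => f g) hs
    rw [toIndTop_apply, Induced.zero_apply, Submodule.Quotient.mk_eq_zero] at h
    rw [← smul_inv_smul g (s.coeff g)]
    exact smul_mem_jacobson g h
  · have : IsSemisimpleModule A (radQuot A) := isSemisimpleModule_quotient_jacobson
    have : IsSemisimpleModule (SkewMonoidAlgebra A G) (Induced G (A ⧸ Ring.jacobson A)) :=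
      isSemisimpleModule_ind c hcomm hfix hcard (radQuot A)
    exact IsSemisimpleModule.jacobson_le_ker _ _ _ _ (toIndTop A G)

/-- The quotient of the skew group algebra by its radical is induced from `A / J`. -/
def radQuotIso [DecidableEq G] [Fintype G] [IsArtinianRing A] (c : A)
    (hcomm : ∀ a : A, a * c = c * a) (hfix : ∀ g : G, g • c = c)
    (hcard : (Fintype.card G : A) * c = 1) :
    radQuot (SkewMonoidAlgebra A G) ≅ (ind A G).obj (radQuot A) :=
  ((Submodule.quotEquivOfEq _ _ (ker_toIndTop c hcomm hfix hcard).symm).trans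
    ((toIndTop A G).quotKerEquivOfSurjective toIndTop_surjective)).toModuleIso

end Radical

/-! ### The diagonal module as an induced module -/

section DiagTensor

open SkewMonoidAlgebra (single)
open scoped ModuleCat

variable {K A G : Type u} [Field K] [Ring A] [Algebra K A] [Group G] [MulSemiringAction G A]
  [SMulCommClass G K A] [DecidableEq G] [Fintype G]

variable (K) in
/-- The map `g ⊗ m ↦ g m ⊗ g` from the module induced from the restriction of `M` to `M ⊗ KG`. -/
def indToDiagTensor (M : ModuleCat.{u} (SkewMonoidAlgebra A G)) :
    Induced G (resA M) →ₗ[SkewMonoidAlgebra A G]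
      DiagTensor M (Representation.leftRegular K G) :=
  Induced.lift (X := resA M)
    { toFun := fun m => diagTmul M (Representation.leftRegular K G) m (MonoidAlgebra.single 1 1)
      map_zero' := TensorProduct.zero_tmul _ _
      map_add' := fun m m' => TensorProduct.add_tmul _ _ _ }
    (fun a m => by
      refine Eq.trans ?_ (single_smul_diagTmul M (Representation.leftRegular K G) 1 a m _).symm
      rw [map_one]
      rfl)

theorem indToDiagTensor_mk (M : ModuleCat.{u} (SkewMonoidAlgebra A G)) (g : G) (m : M) :
    indToDiagTensor K M (Induced.mk (resA M) g m) =
      diagTmul M (Representation.leftRegular K G) (single g (1 : A) • m)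
        (MonoidAlgebra.single g 1) := by
  refine (Induced.lift_mk (X := resA M) _ _ g m).trans
    ((single_smul_diagTmul M (Representation.leftRegular K G) g 1 m _).trans ?_)
  rw [Representation.ofMulAction_single, smul_eq_mul, mul_one]

/-- The `K`-linear map `m ⊗ f ↦ f(g) m` from `M ⊗ KG` to `M`. -/
def diagTensorCoeff (M : ModuleCat.{u} (SkewMonoidAlgebra A G)) (g : G) :
    DiagTensor M (Representation.leftRegular K G) →+ M :=
  (TensorProduct.rid K M ∘ₗ LinearMap.lTensor M
    (Finsupp.lapply g ∘ₗ (MonoidAlgebra.coeffLinearEquiv K).toLinearMap)).toAddMonoidHom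

theorem diagTensorCoeff_tmul (M : ModuleCat.{u} (SkewMonoidAlgebra A G)) (g h : G) (m : M) :
    diagTensorCoeff M g (diagTmul M (Representation.leftRegular K G) m
      (MonoidAlgebra.single h 1)) = if h = g then m else 0 := by
  change (MonoidAlgebra.single h (1 : K)).coeff g • m = _
  rw [MonoidAlgebra.coeff_single, Finsupp.single_apply]
  split <;> simp

/-- The coefficient of the image of f at g is g f(g), and g acts invertibly on M, so the image
determines f. -/
theorem indToDiagTensor_bijective (M : ModuleCat.{u} (SkewMonoidAlgebra A G)) :
    Function.Bijective (indToDiagTensor K M) := by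
  constructor
  · have key : ∀ (g : G) (f : Induced G (resA M)),
        diagTensorCoeff M g (indToDiagTensor K M f) =
          single g (1 : A) • (show M from f g) := by
      intro g f
      let φ : Induced G (resA M) →+ M :=
        (DistribSMul.toAddMonoidHom M (single g (1 : A))).comp
          { toFun := fun f => (f g : resA M)
            map_zero' := rfl
            map_add' := fun _ _ => rfl }
      have : (diagTensorCoeff M g).comp (indToDiagTensor K M).toAddMonoidHom = φ := by
        refine Induced.addHom_ext fun h m => ?_
        change diagTensorCoeff M g (indToDiagTensor K M (Induced.mk (resA M) h m)) =
          single g (1 : A) • (show M from Induced.mk (resA M) h m g)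
        refine (congrArg _ (indToDiagTensor_mk M h m)).trans ?_
        rw [diagTensorCoeff_tmul]
        by_cases hg : h = g
        · subst hg
          rw [if_pos rfl]
          exact congrArg (single h (1 : A) • ·)
            ((Induced.mk_apply (X := resA M) h m h).trans (if_pos rfl)).symm
        · rw [if_neg hg]
          refine (smul_zero (single g (1 : A))).symm.trans (congrArg (single g (1 : A) • ·) ?_)
          exact ((Induced.mk_apply (X := resA M) h m g).trans
            (if_neg fun h' => hg h'.symm)).symm
      exact DFunLike.congr_fun this f
    refine (injective_iff_map_eq_zero (indToDiagTensor K M)).mpr fun f hf => ?_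
    refine Induced.ext fun g => ?_
    have h := key g f
    rw [hf, map_zero] at h
    have inj : ∀ m : M, single g (1 : A) • m = 0 → m = 0 := fun m hm => by
      rw [← one_smul (SkewMonoidAlgebra A G) m, SkewMonoidAlgebra.one_def, ← inv_mul_cancel g,
        ← mul_one (1 : A), ← smul_one g⁻¹, ← SkewMonoidAlgebra.single_mul_single, mul_smul, hm,
        smul_zero]
    exact inj _ h.symm
  · intro t
    change t ∈ (indToDiagTensor K M).toAddMonoidHom.range
    induction t using TensorProduct.induction_on with
    | zero => exact zero_mem _
    | add t t' ht ht' => exact add_mem ht ht'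
    | tmul m w =>
      induction w using MonoidAlgebra.induction_linear with
      | zero =>
        rw [TensorProduct.tmul_zero]
        exact zero_mem _
      | add w w' hw hw' =>
        rw [TensorProduct.tmul_add]
        exact add_mem hw hw'
      | single h r =>
        -- The factor h⁻¹ cancels the action of h on the first tensor factor, and the scalar r is
        -- moved across the tensor product.
        refine ⟨Induced.mk (resA M) h (single h⁻¹ (1 : A) • r • m), ?_⟩
        refine (indToDiagTensor_mk M h _).trans ?_
        rw [smul_smul, SkewMonoidAlgebra.single_mul_single, mul_inv_cancel, smul_one, mul_one,
          ← SkewMonoidAlgebra.one_def, one_smul]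
        change (r • m) ⊗ₜ[K] MonoidAlgebra.single h (1 : K) = m ⊗ₜ[K] MonoidAlgebra.single h r
        rw [TensorProduct.smul_tmul, MonoidAlgebra.smul_single, smul_eq_mul, mul_one]

variable (K) in
/-- The diagonal module `M ⊗ KG` is induced from the restriction of `M`. -/
def diagTensorIso (M : ModuleCat.{u} (SkewMonoidAlgebra A G)) :
    (ind A G).obj (resA M) ≅ diagTensor M (Representation.leftRegular K G) :=
  (LinearEquiv.ofBijective (indToDiagTensor K M) (indToDiagTensor_bijective M)).toModuleIso

end DiagTensor

/-! ### Invariance of Ext and Yoneda algebras under isomorphism -/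

section ExtGenerated

variable {C : Type u} [Category.{v} C] [Abelian C] [HasExt.{w} C] (K : Type*) [Field K] [Linear K C]

/-- The groups `Ext^i(M, L)` are generated in degree `0` under the action of `Ext^1(L, L)`. -/
def ExtGenerated (M L : C) : Prop :=
  ∀ i : ℕ, Submodule.span K {ξ : Ext M L (i + 1) |
    ∃ (α : Ext M L i) (β : Ext L L 1), α.comp β rfl = ξ} = ⊤

/-- Conjugation by isomorphisms on `Ext`. -/
def extConj {M M' L L' : C} (e : M ≅ M') (f : L ≅ L') (n : ℕ) : Ext M L n →ₗ[K] Ext M' L' n where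
  toFun α := (Ext.mk₀ e.inv).comp (α.comp (Ext.mk₀ f.hom) (add_zero n)) (zero_add n)
  map_add' := by simp
  map_smul' := by simp

variable {K}

theorem extConj_apply {M M' L L' : C} (e : M ≅ M') (f : L ≅ L') {n : ℕ} (α : Ext M L n) :
    extConj K e f n α =
      (Ext.mk₀ e.inv).comp (α.comp (Ext.mk₀ f.hom) (add_zero n)) (zero_add n) := rfl

theorem extConj_comp {M M' L L' N N' : C} (e : M ≅ M') (f : L ≅ L') (g : N ≅ N') {a b c : ℕ}
    (α : Ext M L a) (β : Ext L N b) (h : a + b = c) :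
    extConj K e g c (α.comp β h) = (extConj K e f a α).comp (extConj K f g b β) h := by
  rw [extConj_apply, extConj_apply, extConj_apply,
    Ext.comp_assoc (Ext.mk₀ e.inv) _ _ (zero_add a) h (by lia)]
  congr 1
  rw [Ext.comp_assoc_of_third_deg_zero, Ext.comp_assoc_of_second_deg_zero,
    Ext.mk₀_comp_mk₀_assoc, f.hom_inv_id, Ext.mk₀_id_comp]

theorem extConj_id {L L' : C} (f : L ≅ L') :
    extConj K f f 0 (Ext.mk₀ (𝟙 L)) = Ext.mk₀ (𝟙 L') := by
  rw [extConj_apply, Ext.mk₀_id_comp, Ext.mk₀_comp_mk₀, f.inv_hom_id]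

theorem extConj_symm {M M' L L' : C} (e : M ≅ M') (f : L ≅ L') {n : ℕ} (α : Ext M L n) :
    extConj K e.symm f.symm n (extConj K e f n α) = α := by
  rw [extConj_apply, extConj_apply, Ext.comp_assoc_of_third_deg_zero,
    Ext.comp_assoc_of_third_deg_zero, Ext.mk₀_comp_mk₀, Ext.mk₀_comp_mk₀_assoc]
  simp

theorem ExtGenerated.of_iso {M M' L L' : C} (e : M ≅ M') (f : L ≅ L') (h : ExtGenerated K M L) :
    ExtGenerated K M' L' := by
  refine fun i => (Submodule.eq_top_iff'.mpr fun ξ => ?_)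
  have key : ∀ ζ : Ext M L (i + 1), extConj K e f _ ζ ∈ Submodule.span K
      {ξ : Ext M' L' (i + 1) | ∃ (α : Ext M' L' i) (β : Ext L' L' 1), α.comp β rfl = ξ} := by
    intro ζ
    have hζ : ζ ∈ Submodule.span K _ := (h i).symm ▸ Submodule.mem_top
    refine Submodule.span_le (p := (Submodule.span K _).comap (extConj K e f (i + 1))).mpr ?_ hζ
    rintro _ ⟨α, β, rfl⟩
    exact Submodule.subset_span ⟨_, _, (extConj_comp e f f α β rfl).symm⟩
  have := key (extConj K e.symm f.symm _ ξ)
  -- Since `e.symm.symm` is `e` by definition, `extConj_symm` also gives the cancellation in this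
  -- order.
  rwa [show extConj K e f _ (extConj K e.symm f.symm _ ξ) = ξ from
    extConj_symm e.symm f.symm ξ] at this

theorem extGenerated_iff_of_iso {M M' L L' : C} (e : M ≅ M') (f : L ≅ L') :
    ExtGenerated K M L ↔ ExtGenerated K M' L' :=
  ⟨.of_iso e f, .of_iso e.symm f.symm⟩

section Map

variable {D : Type*} [Category* D] [Abelian D] [HasExt.{w} D] [Linear K D]

/-- The homomorphism of Yoneda algebras given by multiplicative linear maps in each degree. -/
def yonedaAlgHom {X : C} {Y : D} (φ : ∀ n, Ext X X n →ₗ[K] Ext Y Y n)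
    (h₁ : φ 0 (Ext.mk₀ (𝟙 X)) = Ext.mk₀ (𝟙 Y))
    (hmul : ∀ (a b : ℕ) (α : Ext X X a) (β : Ext X X b),
      φ (a + b) (α.comp β rfl) = (φ a α).comp (φ b β) rfl) :
    YonedaAlgebra X →ₐ[K] YonedaAlgebra Y :=
  DirectSum.toAlgebra K (fun n : ℕ => Ext X X n)
    (fun n => (DirectSum.lof K ℕ (fun n : ℕ => Ext Y Y n) n).comp (φ n))
    (congrArg (DirectSum.of (fun n : ℕ => Ext Y Y n) 0) h₁)
    (fun {a b} α β => (congrArg (DirectSum.of (fun n : ℕ => Ext Y Y n) (a + b)) (hmul a b α β)).trans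
      (DirectSum.of_mul_of (A := fun n : ℕ => Ext Y Y n) (φ a α) (φ b β)).symm)

theorem yonedaAlgHom_of {X : C} {Y : D} (φ : ∀ n, Ext X X n →ₗ[K] Ext Y Y n)
    (h₁ : φ 0 (Ext.mk₀ (𝟙 X)) = Ext.mk₀ (𝟙 Y))
    (hmul : ∀ (a b : ℕ) (α : Ext X X a) (β : Ext X X b),
      φ (a + b) (α.comp β rfl) = (φ a α).comp (φ b β) rfl) {n : ℕ} (α : Ext X X n) :
    yonedaAlgHom φ h₁ hmul (DirectSum.of (fun n : ℕ => Ext X X n) n α) =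
      DirectSum.of (fun n : ℕ => Ext Y Y n) n (φ n α) :=
  (DirectSum.toAlgebra_apply K (fun n : ℕ => Ext X X n) _ _ _ _).trans
    (DirectSum.toSemiring_of _ _ _ n α)

end Map

theorem yonedaAlgebra_of_mul_of {X : C} {a b c : ℕ} (α : Ext X X a) (β : Ext X X b)
    (h : a + b = c) :
    (DirectSum.of (fun n : ℕ => Ext X X n) a α * DirectSum.of (fun n : ℕ => Ext X X n) b β :
      YonedaAlgebra X) = DirectSum.of (fun n : ℕ => Ext X X n) c (α.comp β h) := by
  subst h
  exact DirectSum.of_mul_of (A := fun n : ℕ => Ext X X n) α β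

variable (K) in
/-- The homomorphism of Yoneda algebras given by an isomorphism. -/
def yonedaConj {X Y : C} (f : X ≅ Y) : YonedaAlgebra X →ₐ[K] YonedaAlgebra Y :=
  yonedaAlgHom (extConj K f f) (extConj_id f) fun _ _ α β => extConj_comp f f f α β rfl

theorem yonedaConj_of {X Y : C} (f : X ≅ Y) {n : ℕ} (α : Ext X X n) :
    yonedaConj K f (DirectSum.of (fun n : ℕ => Ext X X n) n α) =
      DirectSum.of (fun n : ℕ => Ext Y Y n) n (extConj K f f n α) :=
  yonedaAlgHom_of (extConj K f f) (extConj_id f) (fun _ _ α β => extConj_comp f f f α β rfl) α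

theorem yonedaConj_symm {X Y : C} (f : X ≅ Y) :
    (yonedaConj K f.symm).comp (yonedaConj K f) = AlgHom.id K _ :=
  DirectSum.algHom_ext K (fun n : ℕ => Ext X X n) fun n α => by
    rw [AlgHom.comp_apply, yonedaConj_of, yonedaConj_of, extConj_symm, AlgHom.id_apply]

variable (K) in
/-- Isomorphic objects have isomorphic Yoneda algebras. -/
def yonedaCongr {X Y : C} (f : X ≅ Y) : YonedaAlgebra X ≃ₐ[K] YonedaAlgebra Y :=
  AlgEquiv.ofAlgHom (yonedaConj K f) (yonedaConj K f.symm) (yonedaConj_symm f.symm)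
    (yonedaConj_symm f)

theorem yonedaCongr_of {X Y : C} (f : X ≅ Y) {n : ℕ} (α : Ext X X n) :
    yonedaCongr K f (DirectSum.of (fun n : ℕ => Ext X X n) n α) =
      DirectSum.of (fun n : ℕ => Ext Y Y n) n (extConj K f f n α) :=
  yonedaConj_of f α

theorem mem_yonedaGrade {X : C} {n : ℕ} {x : YonedaAlgebra X} :
    x ∈ yonedaGrade K X n ↔ ∃ α, DirectSum.of (fun n : ℕ => Ext X X n) n α = x := Iff.rfl

theorem map_yonedaCongr_yonedaGrade {X Y : C} (f : X ≅ Y) (n : ℕ) :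
    (yonedaGrade K X n).map (yonedaCongr K f).toLinearMap = yonedaGrade K Y n := by
  ext y
  simp only [Submodule.mem_map, mem_yonedaGrade]
  constructor
  · rintro ⟨_, ⟨α, rfl⟩, rfl⟩
    exact ⟨_, (yonedaCongr_of f α).symm⟩
  · rintro ⟨β, rfl⟩
    refine ⟨_, ⟨extConj K f.symm f.symm n β, rfl⟩, (yonedaCongr_of f _).trans ?_⟩
    exact congrArg _ (extConj_symm f.symm f.symm β)

end ExtGenerated

/-! ### Powers of homogeneous subspaces of a skew group algebra -/

section SkewSubmodule

open SkewMonoidAlgebra (single)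

variable {K R G : Type*} [Field K] [Ring R] [Algebra K R] [Group G] [MulSemiringAction G R]
  [SMulCommClass G K R]

variable (G) in
/-- The elements of the skew group algebra with coefficients in `V`. -/
def skewSubmodule (V : Submodule K R) : Submodule K (SkewMonoidAlgebra R G) where
  carrier := {f | ∀ g : G, f.coeff g ∈ V}
  zero_mem' := fun _ => zero_mem _
  add_mem' := fun {f f'} hf hf' g => by
    rw [SkewMonoidAlgebra.coeff_add]
    exact add_mem (hf g) (hf' g)
  smul_mem' := fun r f hf g => by
    rw [SkewMonoidAlgebra.coeff_smul]
    exact Submodule.smul_mem _ r (hf g)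

theorem single_mem_skewSubmodule {V : Submodule K R} {g : G} {v : R} :
    single g v ∈ skewSubmodule G V ↔ v ∈ V := by
  classical
  refine ⟨fun h => by simpa using h g, fun h k => ?_⟩
  rw [SkewMonoidAlgebra.coeff_single, Finsupp.single_apply]
  split
  · exact h
  · exact zero_mem _

theorem skewSubmodule_injective :
    Function.Injective (skewSubmodule (K := K) (R := R) G) := fun V W h => by
  ext v
  rw [← single_mem_skewSubmodule (g := (1 : G)), h, single_mem_skewSubmodule]

/-- Since (vh)(wk) = v h(w) hk, stability of W keeps the coefficients in VW. Conversely (vw)g is the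
product of v·1 and wg. -/
theorem skewSubmodule_mul (V W : Submodule K R) (hW : ∀ (g : G), ∀ w ∈ W, g • w ∈ W) :
    skewSubmodule G V * skewSubmodule G W = skewSubmodule G (V * W) := by
  apply le_antisymm
  · refine Submodule.mul_le.mpr fun f hf f' hf' g => ?_
    rw [SkewMonoidAlgebra.coeff_mul_left, SkewMonoidAlgebra.sum_def]
    exact Submodule.sum_mem _ fun h _ => Submodule.mul_mem_mul (hf h) (hW h _ (hf' _))
  · intro f hf
    rw [← f.sum_single, SkewMonoidAlgebra.sum_def]
    refine Submodule.sum_mem _ fun g _ => ?_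
    refine Submodule.mul_induction_on (C := fun r => single g r ∈ _) (hf g) (fun v hv w hw => ?_)
      fun x y hx hy => ?_
    · have : single g (v * w) = single (1 : G) v * single g w := by
        rw [SkewMonoidAlgebra.single_mul_single, one_mul, one_smul]
      rw [this]
      exact Submodule.mul_mem_mul (single_mem_skewSubmodule.mpr hv)
        (single_mem_skewSubmodule.mpr hw)
    · rw [SkewMonoidAlgebra.single_add]
      exact add_mem hx hy

/-- The exponent has to be positive: in exponent 0 the left side is K·1, while the right side also
contains the elements of `G`. -/
theorem skewSubmodule_pow (V : Submodule K R) (hV : ∀ (g : G), ∀ v ∈ V, g • v ∈ V) (n : ℕ) :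
    skewSubmodule G V ^ (n + 1) = skewSubmodule G (V ^ (n + 1)) := by
  induction n with
  | zero => rw [zero_add, pow_one, pow_one]
  | succ n ih => rw [pow_succ, ih, skewSubmodule_mul _ _ hV, pow_succ V (n + 1)]

end SkewSubmodule

/-! ### Generation of Ext and the Yoneda algebra of an induced module -/

section Main

open SkewMonoidAlgebra (single)

variable {K A G : Type u} [Field K] [Ring A] [Algebra K A] [Group G] [MulSemiringAction G A]
  [SMulCommClass G K A] [DecidableEq G] [Fintype G] {X Y : ModuleCat.{u} A}
  [DistribMulAction G Y] [SMulDistribClass G A Y]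

/-- The coordinates invert the decomposition through the `K`-linear maps `extInd`, so they inherit
linearity. -/
theorem extCoord_smul (g : G) (r : K) {n : ℕ} (ξ : Ext ((ind A G).obj X) ((ind A G).obj Y) n) :
    extCoord g (r • ξ) = r • extCoord g ξ := by
  conv_lhs => rw [← sum_extInd_extCoord ξ, Finset.smul_sum]
  simp_rw [← extInd_smul, map_sum, extCoord_extInd]
  rw [Finset.sum_ite_eq', if_pos (Finset.mem_univ g)]

/-- Downwards, γ is the coordinate at 1 of Ind(γ), and the coordinate at 1 of a product of terms
Ind(α) R_g and Ind(β) R_h is α · gβ or 0. Upwards, Ind(αβ) R_g factors as Ind(α) times Ind(β) R_g,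
the second factor having degree 1. -/
theorem extGenerated_ind_iff :
    ExtGenerated K ((ind A G).obj X) ((ind A G).obj Y) ↔ ExtGenerated K X Y := by
  constructor
  · refine fun h i => Submodule.eq_top_iff'.mpr fun γ => ?_
    let coord : Ext ((ind A G).obj X) ((ind A G).obj Y) (i + 1) →ₗ[K] Ext X Y (i + 1) :=
      { extCoord (1 : G) with map_smul' := fun r ξ => extCoord_smul (1 : G) r ξ }
    have hγ : extInd X Y (i + 1) (1 : G) γ ∈ Submodule.span K _ :=
      (h i).symm ▸ Submodule.mem_top
    have key := Submodule.span_le (p := (Submodule.span K {ξ : Ext X Y (i + 1) |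
      ∃ (α : Ext X Y i) (β : Ext Y Y 1), α.comp β rfl = ξ}).comap coord).mpr ?_ hγ
    · have : coord (extInd X Y (i + 1) (1 : G) γ) = γ :=
        (extCoord_extInd _ _ _).trans (if_pos rfl)
      rwa [Submodule.mem_comap, this] at key
    · rintro _ ⟨ξ, η, rfl⟩
      rw [SetLike.mem_coe, Submodule.mem_comap,
        show coord (ξ.comp η rfl) = extCoord (1 : G) (ξ.comp η rfl) from rfl,
        ← sum_extInd_extCoord ξ, ← sum_extInd_extCoord η, Ext.sum_comp, map_sum]
      refine Submodule.sum_mem _ fun g _ => ?_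
      rw [Ext.comp_sum, map_sum]
      refine Submodule.sum_mem _ fun h _ => ?_
      rw [extInd_comp, extCoord_extInd]
      split
      · exact Submodule.subset_span ⟨_, _, rfl⟩
      · exact zero_mem _
  · refine fun h i => Submodule.eq_top_iff'.mpr fun ξ => ?_
    rw [← sum_extInd_extCoord ξ]
    refine Submodule.sum_mem _ fun g _ => ?_
    let φ : Ext X Y (i + 1) →ₗ[K] Ext ((ind A G).obj X) ((ind A G).obj Y) (i + 1) :=
      { extInd X Y (i + 1) g with map_smul' := extInd_smul g }
    have hξ : extCoord g ξ ∈ Submodule.span K _ := (h i).symm ▸ Submodule.mem_top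
    refine Submodule.span_le (p := (Submodule.span K _).comap φ).mpr ?_ hξ
    rintro _ ⟨α, β, rfl⟩
    refine Submodule.subset_span ⟨extInd X Y i 1 α, extInd Y Y 1 g β, ?_⟩
    rw [extInd_comp, one_mul, extAct_one]
    rfl

variable (K G Y) in
/-- The homomorphism from the Yoneda algebra of `Y` to that of the induced module. -/
def yonedaInd : YonedaAlgebra Y →ₐ[K] YonedaAlgebra ((ind A G).obj Y) :=
  yonedaAlgHom ((ind A G).mapExtLinearMap K Y Y)
    ((Ext.mapExactFunctor_mk₀ _ _).trans (by rw [CategoryTheory.Functor.map_id]))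
    fun _ _ α β => Ext.mapExactFunctor_comp _ α β rfl

theorem yonedaInd_of {n : ℕ} (α : Ext Y Y n) :
    yonedaInd K G Y (DirectSum.of (fun n : ℕ => Ext Y Y n) n α) =
      DirectSum.of (fun n : ℕ => Ext ((ind A G).obj Y) ((ind A G).obj Y) n) n
        (α.mapExactFunctor (ind A G)) :=
  yonedaAlgHom_of _ _ _ α

variable (G Y) in
/-- The right multiplications on the induced module, in degree `0` of its Yoneda algebra. -/
def yonedaRight : G →* YonedaAlgebra ((ind A G).obj Y) where
  toFun g := DirectSum.of (fun n : ℕ => Ext ((ind A G).obj Y) ((ind A G).obj Y) n) 0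
    (Ext.mk₀ (indRight Y g))
  map_one' := by
    rw [indRight_one]
    rfl
  map_mul' g h := by
    rw [yonedaAlgebra_of_mul_of _ _ (zero_add 0), Ext.mk₀_comp_mk₀, indRight_mul]

/-- This is the commutation rule needed to glue the maps on coefficients and on `G` into one
homomorphism on the skew group algebra. -/
theorem yonedaRight_mul_yonedaInd (g : G) (x : YonedaAlgebra Y) :
    yonedaInd K G Y (g • x) * yonedaRight G Y g = yonedaRight G Y g * yonedaInd K G Y x := by
  induction x using DirectSum.induction_on with
  | zero => simp
  | add x y hx hy => simp only [smul_add, map_add, add_mul, mul_add, hx, hy]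
  | of n α =>
    rw [smul_of, yonedaInd_of, yonedaInd_of]
    refine (yonedaAlgebra_of_mul_of _ _ (add_zero n)).trans
      (Eq.trans ?_ (yonedaAlgebra_of_mul_of _ _ (zero_add n)).symm)
    exact congrArg _ (indRight_comp_ind g α).symm

variable (K G Y) in
/-- The homomorphism from the skew group algebra of the Yoneda algebra of `Y` to the Yoneda algebra
of the induced module. -/
def skewYonedaHom :
    SkewMonoidAlgebra (YonedaAlgebra Y) G →ₐ[K] YonedaAlgebra ((ind A G).obj Y) :=
  SkewMonoidAlgebra.liftNCAlgHom (yonedaInd K G Y) (yonedaRight G Y)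
    fun {x g} => yonedaRight_mul_yonedaInd g x

theorem skewYonedaHom_single (g : G) {n : ℕ} (α : Ext Y Y n) :
    skewYonedaHom K G Y (single g (DirectSum.of (fun n : ℕ => Ext Y Y n) n α)) =
      DirectSum.of (fun n : ℕ => Ext ((ind A G).obj Y) ((ind A G).obj Y) n) n
        (extInd Y Y n g α) := by
  refine (SkewMonoidAlgebra.liftNC_single _ _ _ _).trans ?_
  refine (congrArg (· * yonedaRight G Y g) (yonedaInd_of (K := K) α)).trans ?_
  exact yonedaAlgebra_of_mul_of _ _ (add_zero n)

variable (G Y) in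
/-- The decomposition of an element of the Yoneda algebra of the induced module into its
components at the elements of the group. -/
def skewYonedaInv :
    YonedaAlgebra ((ind A G).obj Y) →+ SkewMonoidAlgebra (YonedaAlgebra Y) G :=
  DirectSum.toAddMonoid fun n => ∑ g : G, (SkewMonoidAlgebra.singleAddHom g).comp
    ((DirectSum.of (fun n : ℕ => Ext Y Y n) n).comp (extCoord g))

theorem skewYonedaInv_of {n : ℕ} (ξ : Ext ((ind A G).obj Y) ((ind A G).obj Y) n) :
    skewYonedaInv G Y (DirectSum.of _ n ξ) =
      ∑ g : G, single g (DirectSum.of (fun n : ℕ => Ext Y Y n) n (extCoord g ξ)) := by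
  rw [skewYonedaInv, DirectSum.toAddMonoid_of, AddMonoidHom.finsetSum_apply]
  rfl

theorem skewYonedaHom_inv (x : YonedaAlgebra ((ind A G).obj Y)) :
    skewYonedaHom K G Y (skewYonedaInv G Y x) = x := by
  induction x using DirectSum.induction_on with
  | zero => simp
  | add x y hx hy => rw [map_add, map_add, hx, hy]
  | of n ξ =>
    rw [skewYonedaInv_of, map_sum]
    simp_rw [skewYonedaHom_single]
    rw [← map_sum, sum_extInd_extCoord]

theorem skewYonedaInv_hom (x : SkewMonoidAlgebra (YonedaAlgebra Y) G) :
    skewYonedaInv G Y (skewYonedaHom K G Y x) = x := by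
  induction x using SkewMonoidAlgebra.induction_on with
  | zero => simp
  | add x y hx hy => rw [map_add, map_add, hx, hy]
  | single g a =>
    induction a using DirectSum.induction_on with
    | zero => simp
    | add x y hx hy => rw [SkewMonoidAlgebra.single_add, map_add, map_add, hx, hy]
    | of n α =>
      rw [skewYonedaHom_single, skewYonedaInv_of]
      simp_rw [extCoord_extInd]
      rw [Finset.sum_eq_single g]
      · rw [if_pos rfl]
      · intro h _ hh
        rw [if_neg hh.symm, map_zero, SkewMonoidAlgebra.single_zero]
      · simp

variable (K G Y) in
/-- The Yoneda algebra of the module induced from `Y` is the skew group algebra of the Yoneda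
algebra of `Y`. -/
def skewYonedaEquiv :
    YonedaAlgebra ((ind A G).obj Y) ≃ₐ[K] SkewMonoidAlgebra (YonedaAlgebra Y) G :=
  AlgEquiv.symm
    { skewYonedaHom K G Y with
      invFun := skewYonedaInv G Y
      left_inv := skewYonedaInv_hom
      right_inv := skewYonedaHom_inv }

theorem skewYonedaEquiv_of {n : ℕ} (ξ : Ext ((ind A G).obj Y) ((ind A G).obj Y) n) :
    skewYonedaEquiv K G Y (DirectSum.of _ n ξ) =
      ∑ g : G, single g (DirectSum.of (fun n : ℕ => Ext Y Y n) n (extCoord g ξ)) :=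
  skewYonedaInv_of ξ

theorem map_skewYonedaEquiv_yonedaGrade (n : ℕ) :
    (yonedaGrade K ((ind A G).obj Y) n).map (skewYonedaEquiv K G Y).toLinearMap =
      skewYonedaGrade K Y n := by
  apply le_antisymm
  · rintro _ ⟨_, ⟨ξ, rfl⟩, rfl⟩
    refine (skewYonedaEquiv_of (K := K) ξ).symm ▸ ?_
    -- By definition `skewYonedaGrade` is the `skewSubmodule` of the component of degree n.
    refine Submodule.sum_mem (skewSubmodule G (yonedaGrade K Y n)) fun g _ => ?_
    exact single_mem_skewSubmodule.mpr ⟨_, rfl⟩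
  · intro f hf
    choose α hα using fun g => hf g
    refine ⟨skewYonedaHom K G Y f, ?_, skewYonedaInv_hom f⟩
    rw [← f.sum_single, SkewMonoidAlgebra.sum_def, Finsupp.sum, map_sum]
    refine Submodule.sum_mem _ fun g _ => ?_
    rw [← hα g]
    exact ⟨_, (skewYonedaHom_single g (α g)).symm⟩

theorem smul_mem_yonedaGrade (g : G) {n : ℕ} {x : YonedaAlgebra Y} (hx : x ∈ yonedaGrade K Y n) :
    g • x ∈ yonedaGrade K Y n := by
  obtain ⟨α, rfl⟩ := hx
  exact ⟨_, (smul_of Y g n α).symm⟩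

end Main

end YonedaExt

end

/-! ### The three assertions -/

theorem theorem2 {K A G : Type u} [Field K] [Ring A] [Algebra K A] [FiniteDimensional K A]
    [Group G] [Finite G] [MulSemiringAction G A] [SMulCommClass G K A]
    (hG : ¬ ringChar K ∣ Nat.card G) :
    (∀ M : ModuleCat.{u} (SkewMonoidAlgebra A G), Module.Finite (SkewMonoidAlgebra A G) M →
      (IsQuasiKoszulModule K (SkewMonoidAlgebra A G)
          (diagTensor M (Representation.leftRegular K G)) ↔
        IsQuasiKoszulModule K A (resA M))) ∧
    (IsQuasiKoszulAlgebra K (SkewMonoidAlgebra A G) ↔ IsQuasiKoszulAlgebra K A) ∧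
    ∃ e : YonedaAlgebra (radQuot (SkewMonoidAlgebra A G)) ≃ₐ[K]
        SkewMonoidAlgebra (YonedaAlgebra (radQuot A)) G,
      ∀ n : ℕ, (yonedaGrade K (radQuot (SkewMonoidAlgebra A G)) n).map e.toLinearMap =
        skewYonedaGrade K (radQuot A) n := by
  classical
  have := Fintype.ofFinite G
  have : IsArtinianRing A := IsArtinianRing.of_finite K A
  have hcard : (Fintype.card G : K) ≠ 0 := by
    rwa [Ne, ringChar.spec, ← Nat.card_eq_fintype_card]
  -- The averaging constant is 1/|G|, taken in `K`: its image in `A` is central and fixed by `G`.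
  let θ : radQuot (SkewMonoidAlgebra A G) ≅ (ind A G).obj (radQuot A) :=
    radQuotIso (algebraMap K A (Fintype.card G : K)⁻¹) (fun a => (Algebra.commutes _ a).symm)
      (fun g => smul_algebraMap g _) (by
        rw [← map_natCast (algebraMap K A), ← map_mul, mul_inv_cancel₀ hcard, map_one])
  let e := (yonedaCongr K θ).trans (skewYonedaEquiv K G (radQuot A))
  have he : ∀ n : ℕ, (yonedaGrade K (radQuot (SkewMonoidAlgebra A G)) n).map e.toLinearMap =
      skewYonedaGrade K (radQuot A) n := fun n => by
    rw [← map_skewYonedaEquiv_yonedaGrade, ← map_yonedaCongr_yonedaGrade θ, ← Submodule.map_comp]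
    rfl
  refine ⟨fun M _ => ?_, ?_, e, he⟩
  -- Being quasi-Koszul is `ExtGenerated` with the second module equal to the ring modulo its
  -- radical, by definition.
  · exact (extGenerated_iff_of_iso (diagTensorIso K M).symm θ).trans extGenerated_ind_iff
  · refine forall_congr' fun i => forall_congr' fun hi => ?_
    obtain ⟨n, rfl⟩ : ∃ n, i = n + 1 := ⟨i - 1, by lia⟩
    -- The equality of subspaces is transported along the injective map e. There both sides are
    -- spaces of elements with prescribed coefficients, and such a space determines its coefficient
    -- space.
    rw [← (Submodule.map_injective_of_injective
        (f := e.toLinearMap) e.injective).eq_iff, he]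
    have hpow : (yonedaGrade K (radQuot (SkewMonoidAlgebra A G)) 1 ^ (n + 1)).map e.toLinearMap =
        skewSubmodule G (yonedaGrade K (radQuot A) 1 ^ (n + 1)) := by
      rw [← skewSubmodule_pow _ fun g _ => smul_mem_yonedaGrade g]
      refine (Submodule.map_pow _ e.toAlgHom (n + 1)).trans ?_
      exact congrArg (· ^ (n + 1)) (he 1)
    rw [hpow]
    exact skewSubmodule_injective.eq_iff
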